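/- **General recursions for the non-stationary optimal causal reconstruction.** Setting. Let $n\ge 0$, and for $0\le i\le n$ let $\mathcal X_i,\mathcal Y_i$ be Polish spaces with their Borel $\sigma$-algebras; write $x^i=(x_0,\dots,x_i)$, $\mathcal X_{0,i}=\prod_{j\le i}\mathcal X_j$, and similarly for $y$ (strings with index $-1$ are empty). Let the source law be $P_{X^n}=\bigotimes_{i=0}^n P_{X_i|X^{i-1}}$ with stochastic kernels $P_{X_i|X^{i-1}}$, and let $\rho_{0,i}:\mathcal X_{0,i}\times\mathcal Y_{0,i}\to[0,\infty)$ be measurable, $d_{0,n}(x^n,y^n)=\sum_{i=0}^n\rho_{0,i}(x^i,y^i)$. A stochastic kernel $P=P_{Y^n|X^n}$ is *causal* if, for $P_{X^n}$-almost all $x^n$, $P(dy^n|x^n)=\bigotimes_{i=0}^nP_{Y_i|Y^{i-1},X^i}(dy_i|y^{i-1},x^i)$ for some stochastic kernels $P_{Y_i|Y^{i-1},X^i}$. Put $\ell(P)=\int d_{0,n}\,d(P_{X^n}\otimes P)\in[0,\infty]$, let $\mathbb I(P)\in[0,\infty]$ be the mutual information (the Kullback–Leibler divergence of $P_{X^n}\otimes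 P$ from the product of its marginals), and for $D\ge 0$ $$R^c_{0,n}(D)=\inf\{\mathbb I(P): P\text{ causal},\ \ell(P)\le D\}$$ (with $\inf\emptyset=\infty$). A real $s\le 0$ is called a *Lagrange multiplier* at $D$ if $$R^c_{0,n}(D)=\inf_{P\text{ causal}}\{\mathbb I(P)-s(\ell(P)-D)\}\qquad(\text{with }0\cdot\infty=0).$$ Fix $D\ge 0$. (a) Suppose that $R^c_{0,n}(D_1)<\infty$ for some $0\le D_1<D$, and that either $R^c_{0,n}(D)=0$ or $R^c_{0,n}(D_2)<R^c_{0,n}(D)$ for some $D_2\ge0$. Then a Lagrange multiplier $s\le0$ at $D$ exists. (b) Suppose $R^c_{0,n}(D)<\infty$, let $P^*$ be causal with $\ell(P^*)\le D$ and $\mathbb I(P^*)=R^c_{0,n}(D)$, let $P^*_{Y_i|Y^{i-1},X^i}$, $0\le i\le n$, be stochastic kernels whose causal product is $P^*$ ($P_{X^n}$-a.s.), let $P^*_{Y_i|Y^{i-1}}$ be regular conditional distributions of $Y_i$ given $Y^{i-1}$ under $P_{X^n}\otimes P^*$, and let $s\le0$ be a Lagrange multiplier at $D$. Define $g_{i,n}:\mathcal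 X_{0,i}\times\mathcal Y_{0,i}\to[0,\infty]$ backward in time by $g_{n,n}=0$ and, for $i=n-1,\dots,0$, $$g_{i,n}(x^i,y^i)=-\int_{\mathcal X_{i+1}}P_{X_{i+1}|X^i}(dx_{i+1}|x^i)\,\log\int_{\mathcal Y_{i+1}}e^{s\rho_{0,i+1}(x^{i+1},y^{i+1})-g_{i+1,n}(x^{i+1},y^{i+1})}P^*_{Y_{i+1}|Y^i}(dy_{i+1}|y^i)$$ (with $e^{-\infty}=0$, $\log 0=-\infty$), and put $Z_i(x^i,y^{i-1})=\int_{\mathcal Y_i}e^{s\rho_{0,i}-g_{i,n}}P^*_{Y_i|Y^{i-1}}(dy_i|y^{i-1})$. Then: 1. for every $0\le i\le n$ and almost every $(x^i,y^{i-1})$ with respect to the law of $(X^i,Y^{i-1})$ under $P_{X^n}\otimes P^*$, one has $0<Z_i(x^i,y^{i-1})<\infty$ and $$P^*_{Y_i|Y^{i-1},X^i}(dy_i|y^{i-1},x^i)=\frac{e^{s\rho_{0,i}(x^i,y^i)-g_{i,n}(x^i,y^i)}\,P^*_{Y_i|Y^{i-1}}(dy_i|y^{i-1})}{Z_i(x^i,y^{i-1})};$$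 2. for every $0\le i\le n$, $g_{i,n}(X^i,Y^i)$ and $-\log Z_i(X^i,Y^{i-1})\ge0$ have finite expectation under $P_{X^n}\otimes P^*$, and $$R^c_{0,n}(D)=sD+\sum_{i=0}^n\int_{\mathcal X_{0,i-1}\times\mathcal Y_{0,i-1}}\Big(\bigotimes_{j=0}^{i-1}P_{X_j|X^{j-1}}(dx_j|x^{j-1})\otimes P^*_{Y_j|Y^{j-1},X^j}(dy_j|y^{j-1},x^j)\Big)\int_{\mathcal X_i}P_{X_i|X^{i-1}}(dx_i|x^{i-1})\Big(-\int_{\mathcal Y_i}g_{i,n}\,P^*_{Y_i|Y^{i-1},X^i}(dy_i|y^{i-1},x^i)-\log Z_i(x^i,y^{i-1})\Big).$$ -/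

import Mathlib

open MeasureTheory ProbabilityTheory
open scoped NNReal ENNReal

noncomputable section

namespace CausalRDF

universe u v

/-- Strings `(a_0, …, a_{m-1})` of length `m` with `a_j ∈ A j`, as an iterated product. -/
def Hist (A : ℕ → Type u) : ℕ → Type u
  | 0 => PUnit
  | m + 1 => Hist A m × A m

/-- The product σ-algebra on strings. -/
instance instMeasurableSpaceHist (A : ℕ → Type u) [∀ i, MeasurableSpace (A i)] :
    (m : ℕ) → MeasurableSpace (Hist A m)
  | 0 => (inferInstance : MeasurableSpace PUnit)
  | m + 1 =>
    letI := instMeasurableSpaceHist A m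
    (inferInstance : MeasurableSpace (Hist A m × A m))

/-- Append a letter to a string. -/
def Hist.snoc {A : ℕ → Type u} {m : ℕ} (h : Hist A m) (a : A m) : Hist A (m + 1) := (h, a)

/-- Delete the last letter of a string. -/
def Hist.init {A : ℕ → Type u} {m : ℕ} (h : Hist A (m + 1)) : Hist A m := Prod.fst h

theorem Hist.measurable_init {A : ℕ → Type u} [∀ i, MeasurableSpace (A i)] {m : ℕ} :
    Measurable (Hist.init : Hist A (m + 1) → Hist A m) :=
  measurable_fst (α := Hist A m) (β := A m)

variable {X : ℕ → Type u} {Y : ℕ → Type v}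
  [∀ i, MeasurableSpace (X i)] [∀ i, MeasurableSpace (Y i)]

/-- The law of the first `m` source letters, `κ i` being the conditional law of `X_i` given
`(X_0, …, X_{i-1})`. -/
def sourceLaw (κ : ∀ i, Kernel (Hist X i) (X i)) : (m : ℕ) → Measure (Hist X m)
  | 0 => Measure.dirac PUnit.unit
  | m + 1 => (sourceLaw κ m ⊗ₘ κ m : Measure (Hist X m × X m))

/-- The causal product `⊗_{i < m} q_i(dy_i | y^{i-1}, x^i)` as a kernel from source strings to
reproduction strings; `q i` takes as argument the pair `(x^i, y^{i-1})`. -/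
def causalProduct (q : ∀ i, Kernel (Hist X (i + 1) × Hist Y i) (Y i)) :
    (m : ℕ) → Kernel (Hist X m) (Hist Y m)
  | 0 => Kernel.const _ (Measure.dirac PUnit.unit)
  | m + 1 =>
    ((causalProduct q m).comap Hist.init Hist.measurable_init ⊗ₖ q m :
      Kernel (Hist X (m + 1)) (Hist Y m × Y m))

/-- The joint law of the first `m` source letters and the first `m` reproduction letters. -/
def jointLaw (κ : ∀ i, Kernel (Hist X i) (X i))
    (q : ∀ i, Kernel (Hist X (i + 1) × Hist Y i) (Y i)) (m : ℕ) :
    Measure (Hist X m × Hist Y m) :=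
  sourceLaw κ m ⊗ₘ causalProduct q m

/-- The law of the first `m` reproduction letters. -/
def outputLaw (κ : ∀ i, Kernel (Hist X i) (X i))
    (q : ∀ i, Kernel (Hist X (i + 1) × Hist Y i) (Y i)) (m : ℕ) : Measure (Hist Y m) :=
  (jointLaw κ q m).map Prod.snd

/-- `ν i` is a regular conditional distribution of `Y_i` given `(Y_0, …, Y_{i-1})`, for `i ≤ n`. -/
def IsOutputConditional (κ : ∀ i, Kernel (Hist X i) (X i))
    (q : ∀ i, Kernel (Hist X (i + 1) × Hist Y i) (Y i)) (n : ℕ)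
    (ν : ∀ i, Kernel (Hist Y i) (Y i)) : Prop :=
  ∀ i ≤ n, outputLaw κ q (i + 1) = (outputLaw κ q i ⊗ₘ ν i : Measure (Hist Y i × Y i))

/-- Mutual information `I(μ, P) = D(μ ⊗ P ‖ μ × P_Y)` of an input law and a channel. -/
def mutualInfo {α β : Type*} [MeasurableSpace α] [MeasurableSpace β] (μ : Measure α)
    (P : Kernel α β) : ℝ≥0∞ :=
  InformationTheory.klDiv (μ ⊗ₘ P) (μ.prod ((μ ⊗ₘ P).map Prod.snd))

/-- The additive distortion `∑_{i < m} ρ_i(x^i, y^i)` of two strings of length `m`. -/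
def distortion (ρ : ∀ i, Hist X (i + 1) → Hist Y (i + 1) → ℝ≥0) :
    (m : ℕ) → Hist X m → Hist Y m → ℝ≥0
  | 0, _, _ => 0
  | m + 1, x, y => distortion ρ m x.init y.init + ρ m x y

/-- The average distortion of a channel from `X^n` to `Y^n`. -/
def avgDistortion (κ : ∀ i, Kernel (Hist X i) (X i))
    (ρ : ∀ i, Hist X (i + 1) → Hist Y (i + 1) → ℝ≥0) (n : ℕ)
    (P : Kernel (Hist X (n + 1)) (Hist Y (n + 1))) : ℝ≥0∞ :=
  ∫⁻ z, (distortion ρ (n + 1) z.1 z.2 : ℝ≥0∞) ∂(sourceLaw κ (n + 1) ⊗ₘ P)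

/-- The Markov kernels from `X^n` to `Y^n` that are almost surely equal to a causal product. -/
def causalKernels (κ : ∀ i, Kernel (Hist X i) (X i)) (n : ℕ) :
    Set (Kernel (Hist X (n + 1)) (Hist Y (n + 1))) :=
  {P | IsMarkovKernel P ∧ ∃ q : ∀ i, Kernel (Hist X (i + 1) × Hist Y i) (Y i),
    (∀ i, IsMarkovKernel (q i)) ∧
      ∀ᵐ x ∂(sourceLaw κ (n + 1)), P x = causalProduct q (n + 1) x}

/-- The causal kernels whose average distortion is at most `D`. -/
def fidelitySet (κ : ∀ i, Kernel (Hist X i) (X i))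
    (ρ : ∀ i, Hist X (i + 1) → Hist Y (i + 1) → ℝ≥0) (n : ℕ) (D : ℝ≥0) :
    Set (Kernel (Hist X (n + 1)) (Hist Y (n + 1))) :=
  {P | P ∈ causalKernels κ n ∧ avgDistortion κ ρ n P ≤ D}

/-- The causal rate distortion function (`∞` if no causal kernel meets the constraint). -/
def causalRDF (κ : ∀ i, Kernel (Hist X i) (X i))
    (ρ : ∀ i, Hist X (i + 1) → Hist Y (i + 1) → ℝ≥0) (n : ℕ) (D : ℝ≥0) : ℝ≥0∞ :=
  ⨅ P ∈ fidelitySet κ ρ n D, mutualInfo (sourceLaw κ (n + 1)) P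

/-- `s ≤ 0` is a Lagrange multiplier of the distortion constraint: the constrained infimum
equals the infimum of `I(P) - s (ℓ(P) - D)` over all causal kernels. -/
def IsLagrangeMultiplier (κ : ∀ i, Kernel (Hist X i) (X i))
    (ρ : ∀ i, Hist X (i + 1) → Hist Y (i + 1) → ℝ≥0) (n : ℕ) (D : ℝ≥0) (s : ℝ) : Prop :=
  s ≤ 0 ∧
    (causalRDF κ ρ n D : EReal) =
      ⨅ P ∈ (causalKernels κ n : Set (Kernel (Hist X (n + 1)) (Hist Y (n + 1)))),
        ((mutualInfo (sourceLaw κ (n + 1)) P : EReal) -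
          (s : EReal) * ((avgDistortion κ ρ n P : EReal) - ((D : ℝ) : EReal)))

/-- The weight `e^{s r - g}`, with `e^{-∞} = 0`. -/
def gibbsWeight (s : ℝ) (r : ℝ≥0) (g : ℝ≥0∞) : ℝ≥0∞ :=
  EReal.exp (((s * r : ℝ) : EReal) - (g : EReal))

/-- The backward recursion, indexed by the number `k` of stages that follow stage `i`.
As `s ≤ 0`, the logarithm is nonpositive, so its negative is an element of `[0, ∞]`. -/
def gAux (κ : ∀ i, Kernel (Hist X i) (X i))
    (ρ : ∀ i, Hist X (i + 1) → Hist Y (i + 1) → ℝ≥0)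
    (ν : ∀ i, Kernel (Hist Y i) (Y i)) (s : ℝ) :
    (k i : ℕ) → Hist X (i + 1) → Hist Y (i + 1) → ℝ≥0∞
  | 0, _, _, _ => 0
  | k + 1, i, x, y =>
    ∫⁻ x', (-ENNReal.log (∫⁻ y',
      gibbsWeight s (ρ (i + 1) (x.snoc x') (y.snoc y'))
        (gAux κ ρ ν s k (i + 1) (x.snoc x') (y.snoc y'))
        ∂(ν (i + 1) y))).toENNReal ∂(κ (i + 1) x)

/-- The function `g_{i,n}`, for `i ≤ n`. -/
def g (κ : ∀ i, Kernel (Hist X i) (X i))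
    (ρ : ∀ i, Hist X (i + 1) → Hist Y (i + 1) → ℝ≥0)
    (ν : ∀ i, Kernel (Hist Y i) (Y i)) (s : ℝ) (n i : ℕ) :
    Hist X (i + 1) → Hist Y (i + 1) → ℝ≥0∞ :=
  gAux κ ρ ν s (n - i) i

/-- The Gibbs density `e^{s ρ_i - g_{i,n}}` at `(x^i, (y^{i-1}, y_i))`. -/
def stageWeight (κ : ∀ i, Kernel (Hist X i) (X i))
    (ρ : ∀ i, Hist X (i + 1) → Hist Y (i + 1) → ℝ≥0)
    (ν : ∀ i, Kernel (Hist Y i) (Y i)) (s : ℝ) (n i : ℕ)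
    (x : Hist X (i + 1)) (y : Hist Y i) (y' : Y i) : ℝ≥0∞ :=
  gibbsWeight s (ρ i x (y.snoc y')) (g κ ρ ν s n i x (y.snoc y'))

/-- The partition function `∫ e^{s ρ_i - g_{i,n}} ν_i(dy_i | y^{i-1})`. -/
def partitionFn (κ : ∀ i, Kernel (Hist X i) (X i))
    (ρ : ∀ i, Hist X (i + 1) → Hist Y (i + 1) → ℝ≥0)
    (ν : ∀ i, Kernel (Hist Y i) (Y i)) (s : ℝ) (n i : ℕ)
    (x : Hist X (i + 1)) (y : Hist Y i) : ℝ≥0∞ :=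
  ∫⁻ y', stageWeight κ ρ ν s n i x y y' ∂(ν i y)

end CausalRDF

end

/-! For the optimal channel, take its output conditionals `ν` as a fixed reference. For any causal
channel `q`, the chain rule `klDiv_jointLaw_eq_sum` splits the divergence from source law times
`ν`-law, plus `-s` times the distortion, into a sum of `stageCost`s. At each stage the Gibbs
identity `klDiv_compProd_add_lintegral`, with potential `-s ρ_i + g_i`, turns cost plus mean of
`g_i` into the divergence from the Gibbs kernel (`stageGap`) plus the mean of `-log Z_i`
(`stageValue`). The recursion for `g` says precisely that the mean of `g_i` is the mean of `-log
Z_{i+1}`, so the identities telescope: by `sum_stageCost`, total cost = sum of gaps + initial value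
`V_0`, and `V_0` does not depend on `q`.

The optimal channel has total cost `R(D) - sD`. The channel made of Gibbs kernels has cost `V_0`,
and its Lagrangian is no larger, since replacing the reference by its own output law only lowers the
divergence (`mutualInfo_le`). The multiplier inequality for that channel gives `R(D) - sD ≤ V_0`, so
all gaps of the optimal channel vanish. Zero gaps are the Gibbs form of the kernels, and `V_0 = R(D)
- sD` is the rate formula. The stage identities live in `[0, ∞]` and use additions only, so no
integrability is needed in advance.

For the existence of a multiplier, mixtures of causal joint laws are causal and the divergence is
jointly convex, so pairs (distortion, information) can be mixed, and a supporting line at `(D,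
R(D))` gives `s`. -/

open InformationTheory

namespace CausalRDF

universe u v

/-! ### Kullback–Leibler divergence: change of reference, convexity, optimal output law -/

/-- The Kullback–Leibler divergence is invariant under measurable equivalences. -/
theorem klDiv_map_measurableEquiv {α β : Type*} [MeasurableSpace α] [MeasurableSpace β]
    (μ ν : Measure α) [IsFiniteMeasure μ] [IsFiniteMeasure ν] (e : α ≃ᵐ β) :
    klDiv (μ.map e) (ν.map e) = klDiv μ ν := by
  refine le_antisymm (klDiv_map_le μ ν e.measurable) ?_
  have h := klDiv_map_le (μ.map e) (ν.map e) e.symm.measurable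
  simpa [Measure.map_map e.symm.measurable e.measurable] using h

/-- Change of reference measure for the Kullback–Leibler divergence, from `ν` to the measure with
density `e^{c - f}` with respect to `ν`. -/
theorem klDiv_add_lintegral_eq {Ω : Type*} [MeasurableSpace Ω] (μ ν : Measure Ω)
    [IsProbabilityMeasure μ] [IsProbabilityMeasure ν] {f : Ω → ℝ≥0∞} {c : Ω → ℝ≥0} {h : Ω → ℝ≥0∞}
    (hf : Measurable f) (hc : Measurable c) (hh : Measurable h)
    [IsProbabilityMeasure (ν.withDensity h)]
    (hfc : ∀ᵐ x ∂ν, h x = EReal.exp (((c x : ℝ) : EReal) - (f x : EReal))) :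
    klDiv μ ν + ∫⁻ x, f x ∂μ = klDiv μ (ν.withDensity h) + ∫⁻ x, c x ∂μ := by
  by_cases hac : μ ≪ ν.withDensity h
  · have hac' : μ ≪ ν := hac.trans (withDensity_absolutelyContinuous _ _)
    set v := μ.rnDeriv (ν.withDensity h) with hv
    have hvm : Measurable v := Measure.measurable_rnDeriv _ _
    have hu : μ.rnDeriv ν =ᵐ[ν] fun x ↦ h x * v x := by
      have : μ = ν.withDensity (fun x ↦ h x * v x) := by
        conv_lhs => rw [← Measure.withDensity_rnDeriv_eq _ _ hac]
        exact (withDensity_mul ν hh hvm).symm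
      conv_lhs => rw [this]
      exact Measure.rnDeriv_withDensity _ (hh.mul hvm)
    have hvtop : ∀ᵐ x ∂ν, h x ≠ 0 → v x < ∞ :=
      (ae_withDensity_iff hh).1 (Measure.rnDeriv_lt_top _ _)
    -- With `u = h v` and `log h = c - f`, the terms of `klFun u = u log u + 1 - u` rearrange to
    -- this identity. The summands `h x` and `1` are there to avoid subtraction; both integrate to
    -- `1` and cancel.
    have key : ∀ᵐ x ∂ν, ENNReal.ofReal (klFun (μ.rnDeriv ν x).toReal)
        + μ.rnDeriv ν x * f x + h x =
        h x * ENNReal.ofReal (klFun (v x).toReal) + μ.rnDeriv ν x * c x + 1 := by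
      filter_upwards [hu, hvtop, hfc] with x hux hvx hfx
      rw [hux]
      by_cases hfx' : f x = ∞
      · have : h x = 0 := by simp [hfx, hfx']
        simp [this, klFun_zero]
      lift f x to ℝ≥0 using hfx' with F
      have hx : h x = ENNReal.ofReal (Real.exp (c x - F)) := by
        rw [hfx, ← EReal.exp_coe]; rfl
      have h0 : h x ≠ 0 := by simp [hx, Real.exp_pos]
      have hvx := hvx h0
      lift v x to ℝ≥0 using hvx.ne with V
      rw [hx]
      have e1 : (ENNReal.ofReal (Real.exp (c x - F)) * (V : ℝ≥0∞)) =
          ENNReal.ofReal (Real.exp (c x - F) * V) := by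
        rw [ENNReal.ofReal_mul (Real.exp_pos _).le, ENNReal.ofReal_coe_nnreal]
      have e2 (a : ℝ≥0) : (a : ℝ≥0∞) = ENNReal.ofReal a := ENNReal.ofReal_coe_nnreal.symm
      have hE := (Real.exp_pos (c x - F)).le
      have hV : (0:ℝ) ≤ V := V.2
      rw [e1, ENNReal.toReal_ofReal (by positivity), ENNReal.coe_toReal, e2 F, e2 (c x),
        ← ENNReal.ofReal_mul (by positivity), ← ENNReal.ofReal_mul (by positivity),
        ← ENNReal.ofReal_mul (by positivity), ← ENNReal.ofReal_one,
        ← ENNReal.ofReal_add (klFun_nonneg (by positivity)) (by positivity),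
        ← ENNReal.ofReal_add (add_nonneg (klFun_nonneg (by positivity)) (by positivity)) hE,
        ← ENNReal.ofReal_add (mul_nonneg hE (klFun_nonneg hV)) (by positivity),
        ← ENNReal.ofReal_add
          (add_nonneg (mul_nonneg hE (klFun_nonneg hV)) (by positivity)) zero_le_one]
      congr 1
      simp only [klFun_apply]
      rcases eq_or_ne V 0 with rfl | hV0
      · simp; ring
      · rw [Real.log_mul (Real.exp_pos _).ne' (by exact_mod_cast hV0), Real.log_exp]
        ring
    have hint := lintegral_congr_ae key
    have m1 : Measurable fun x ↦ ENNReal.ofReal (klFun (μ.rnDeriv ν x).toReal) := by fun_prop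
    have m2 : Measurable fun x ↦ h x * ENNReal.ofReal (klFun (v x).toReal) := by fun_prop
    have m3 : Measurable fun x ↦ μ.rnDeriv ν x * f x := by fun_prop
    have m4 : Measurable fun x ↦ μ.rnDeriv ν x * (c x : ℝ≥0∞) := by fun_prop
    have h1 : ∫⁻ x, h x ∂ν = 1 := by
      rw [← setLIntegral_univ, ← withDensity_apply _ MeasurableSet.univ, measure_univ]
    rw [lintegral_add_right _ hh, lintegral_add_left m1, lintegral_add_right _ measurable_const,
      lintegral_add_left m2, lintegral_rnDeriv_mul hac' hf.aemeasurable,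
      lintegral_rnDeriv_mul hac' hc.coe_nnreal_ennreal.aemeasurable, h1, lintegral_one,
      measure_univ, ← klDiv_eq_lintegral_klFun_of_ac hac'] at hint
    have h2 : ∫⁻ x, h x * ENNReal.ofReal (klFun (v x).toReal) ∂ν = klDiv μ (ν.withDensity h) := by
      rw [klDiv_eq_lintegral_klFun_of_ac hac,
        lintegral_withDensity_eq_lintegral_mul _ hh (by fun_prop)]
      rfl
    rw [h2] at hint
    exact (ENNReal.add_left_inj ENNReal.one_ne_top).1 hint
  · rw [klDiv_of_not_ac hac, top_add]
    by_cases hac' : μ ≪ ν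
    swap
    · rw [klDiv_of_not_ac hac', top_add]
    -- If `f` were `μ`-integrable, then `h` would be positive `μ`-a.e., and `μ ≪ ν` would give `μ ≪
    -- ν.withDensity h`.
    have : ∫⁻ x, f x ∂μ = ∞ := by
      by_contra hne
      have hfin : ∀ᵐ x ∂μ, f x < ∞ := ae_lt_top hf hne
      refine hac (Measure.AbsolutelyContinuous.mk fun s hs h0 ↦ ?_)
      rw [withDensity_apply _ hs, setLIntegral_eq_zero_iff hs hh] at h0
      have h3 := hac'.ae_le h0
      have h4 := hac'.ae_le hfc
      have : ∀ᵐ x ∂μ, x ∉ s := by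
        filter_upwards [hfin, h3, h4] with x h5 h6 h7 hxs
        rw [h6 hxs] at h7
        have h8 := EReal.exp_eq_zero_iff.1 h7.symm
        lift f x to ℝ≥0 using h5.ne with F
        exact EReal.coe_ne_bot ((c x : ℝ) - (F : ℝ)) h8
      simpa [ae_iff] using this
    rw [this, add_top]

/-- Subadditivity, hence joint convexity, of the Kullback–Leibler divergence. -/
theorem klDiv_add_le {Ω : Type*} [MeasurableSpace Ω] (μ₁ μ₂ ν₁ ν₂ : Measure Ω)
    [IsFiniteMeasure μ₁] [IsFiniteMeasure μ₂] [IsFiniteMeasure ν₁] [IsFiniteMeasure ν₂] :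
    klDiv (μ₁ + μ₂) (ν₁ + ν₂) ≤ klDiv μ₁ ν₁ + klDiv μ₂ ν₂ := by
  by_cases h₁ : μ₁ ≪ ν₁
  swap; · simp [klDiv_of_not_ac h₁]
  by_cases h₂ : μ₂ ≪ ν₂
  swap; · simp [klDiv_of_not_ac h₂]
  set ν := ν₁ + ν₂ with hν
  have a₁ : ν₁ ≪ ν := Measure.absolutelyContinuous_of_le (Measure.le_add_right le_rfl)
  have a₂ : ν₂ ≪ ν := Measure.absolutelyContinuous_of_le (Measure.le_add_left le_rfl)
  have h : μ₁ + μ₂ ≪ ν := (h₁.trans a₁).add_left (h₂.trans a₂)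
  have e (μ' ν' : Measure Ω) [IsFiniteMeasure μ'] [IsFiniteMeasure ν'] (h' : μ' ≪ ν')
      (a' : ν' ≪ ν) : klDiv μ' ν' =
      ∫⁻ x, ν'.rnDeriv ν x * ENNReal.ofReal (klFun (μ'.rnDeriv ν' x).toReal) ∂ν := by
    rw [klDiv_eq_lintegral_klFun_of_ac h', lintegral_rnDeriv_mul a' (by fun_prop)]
  rw [e μ₁ ν₁ h₁ a₁, e μ₂ ν₂ h₂ a₂, klDiv_eq_lintegral_klFun_of_ac h,
    ← lintegral_add_left (by fun_prop)]
  have hone : ∀ᵐ x ∂ν, ν₁.rnDeriv ν x + ν₂.rnDeriv ν x = 1 := by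
    filter_upwards [Measure.rnDeriv_add' ν₁ ν₂ ν, Measure.rnDeriv_self ν] with x hx hx'
    rw [← hx', hν]
    exact hx.symm
  have m (μ' ν' : Measure Ω) [IsFiniteMeasure μ'] [IsFiniteMeasure ν'] (h' : μ' ≪ ν') :
      ∀ᵐ x ∂ν, μ'.rnDeriv ν x = μ'.rnDeriv ν' x * ν'.rnDeriv ν x := by
    filter_upwards [Measure.rnDeriv_mul_rnDeriv h' (κ := ν)] with x hx using hx.symm
  have top (μ' ν' : Measure Ω) [IsFiniteMeasure μ'] [IsFiniteMeasure ν'] (a' : ν' ≪ ν) :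
      ∀ᵐ x ∂ν, ν'.rnDeriv ν x ≠ 0 → μ'.rnDeriv ν' x < ∞ := by
    rw [← ae_withDensity_iff (Measure.measurable_rnDeriv _ _), Measure.withDensity_rnDeriv_eq _ _ a']
    exact Measure.rnDeriv_lt_top _ _
  refine lintegral_mono_ae ?_
  filter_upwards [hone, m μ₁ ν₁ h₁, m μ₂ ν₂ h₂, Measure.rnDeriv_add' μ₁ μ₂ ν,
    top μ₁ ν₁ a₁, top μ₂ ν₂ a₂, ν₁.rnDeriv_lt_top ν, ν₂.rnDeriv_lt_top ν]
    with x hx hm₁ hm₂ hadd ht₁ ht₂ hl₁ hl₂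
  rw [hadd, Pi.add_apply, hm₁, hm₂]
  generalize μ₁.rnDeriv ν₁ x = u₁ at *
  generalize μ₂.rnDeriv ν₂ x = u₂ at *
  generalize ν₁.rnDeriv ν x = b₁ at *
  generalize ν₂.rnDeriv ν x = b₂ at *
  lift b₁ to ℝ≥0 using hl₁.ne
  lift b₂ to ℝ≥0 using hl₂.ne
  have hx' : (b₁ : ℝ) + b₂ = 1 := by exact_mod_cast hx
  have f (b : ℝ≥0) (u : ℝ≥0∞) (hu : (b : ℝ≥0∞) ≠ 0 → u < ∞) : u * b ≠ ∞ := by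
    rcases eq_or_ne b 0 with rfl | hb
    · simp
    · exact ENNReal.mul_ne_top (hu (by simpa using hb)).ne ENNReal.coe_ne_top
  rw [ENNReal.toReal_add (f _ _ ht₁) (f _ _ ht₂), ENNReal.toReal_mul, ENNReal.toReal_mul]
  -- Relative to `ν₁ + ν₂` the densities `b₁`, `b₂` of the references sum to `1`, so they serve as
  -- weights in a pointwise convexity inequality.
  have hconv := convexOn_klFun.2 (x := u₁.toReal) ENNReal.toReal_nonneg
    (y := u₂.toReal) ENNReal.toReal_nonneg b₁.coe_nonneg b₂.coe_nonneg hx'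
  simp only [smul_eq_mul] at hconv
  have e2 (a : ℝ≥0) : (a : ℝ≥0∞) = ENNReal.ofReal a := ENNReal.ofReal_coe_nnreal.symm
  rw [ENNReal.coe_toReal, ENNReal.coe_toReal, e2 b₁, e2 b₂, ← ENNReal.ofReal_mul b₁.coe_nonneg,
    ← ENNReal.ofReal_mul b₂.coe_nonneg,
    ← ENNReal.ofReal_add (mul_nonneg b₁.coe_nonneg (klFun_nonneg ENNReal.toReal_nonneg))
      (mul_nonneg b₂.coe_nonneg (klFun_nonneg ENNReal.toReal_nonneg))]
  refine ENNReal.ofReal_le_ofReal ?_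
  simpa [mul_comm] using hconv

/-- Among all output laws, the divergence `D(μ ⊗ P ‖ μ × η)` is least at the output law of `P`. -/
theorem mutualInfo_le {α β : Type*} [MeasurableSpace α] [StandardBorelSpace α]
    [MeasurableSpace β] (μ : Measure α) [IsProbabilityMeasure μ] (P : Kernel α β)
    [IsMarkovKernel P] (η : Measure β) [IsProbabilityMeasure η] :
    mutualInfo μ P ≤ klDiv (μ ⊗ₘ P) (μ.prod η) := by
  have : Nonempty α := nonempty_of_isProbabilityMeasure μ
  have hswap (π : Measure β) [IsProbabilityMeasure π] :
      klDiv (μ ⊗ₘ P) (μ.prod π) = klDiv ((μ ⊗ₘ P).map Prod.swap) (π ⊗ₘ Kernel.const β μ) := by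
    rw [Measure.compProd_const, ← Measure.prod_swap (μ := μ) (ν := π),
      ← klDiv_map_measurableEquiv _ _ MeasurableEquiv.prodComm]
    rfl
  set ζ := (μ ⊗ₘ P).map Prod.swap with hζ
  have hζp : IsProbabilityMeasure ζ := Measure.isProbabilityMeasure_map (by fun_prop)
  have hfst : ζ.fst = (μ ⊗ₘ P).map Prod.snd := by
    rw [hζ, Measure.fst_map_swap]; rfl
  have hP : IsProbabilityMeasure ((μ ⊗ₘ P).map Prod.snd) :=
    Measure.isProbabilityMeasure_map (by fun_prop)
  -- Disintegrating over the output, the two divergences share the conditional term, and the output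
  -- marginal terms are `0` and `D(P_Y ‖ η)`. The swap is made because the chain rule splits off the
  -- first coordinate.
  rw [mutualInfo, hswap, hswap, ← ζ.disintegrate ζ.condKernel, hfst,
    klDiv_compProd_eq_add (ν := η), klDiv_compProd_eq_add, klDiv_self, zero_add]
  exact le_add_self

theorem Hist.measurable_snoc {A : ℕ → Type u} [∀ i, MeasurableSpace (A i)] {m : ℕ} :
    Measurable (fun p : Hist A m × A m ↦ p.1.snoc p.2) :=
  measurable_id

instance instStandardBorelSpaceHist (A : ℕ → Type u) [∀ i, MeasurableSpace (A i)]
    [∀ i, StandardBorelSpace (A i)] : (m : ℕ) → StandardBorelSpace (Hist A m)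
  | 0 => inferInstanceAs (StandardBorelSpace PUnit)
  | m + 1 =>
    letI := instStandardBorelSpaceHist A m
    inferInstanceAs (StandardBorelSpace (Hist A m × A m))

/-! ### Causal joint laws and their chain rules -/

section JointLaws

variable {X : ℕ → Type u} {Y : ℕ → Type v}
  [∀ i, MeasurableSpace (X i)] [∀ i, MeasurableSpace (Y i)]

instance instIsProbabilityMeasureSourceLaw (κ : ∀ i, Kernel (Hist X i) (X i))
    [∀ i, IsMarkovKernel (κ i)] : (m : ℕ) → IsProbabilityMeasure (sourceLaw κ m)
  | 0 => inferInstanceAs (IsProbabilityMeasure (Measure.dirac PUnit.unit))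
  | m + 1 =>
    letI := instIsProbabilityMeasureSourceLaw κ m
    inferInstanceAs (IsProbabilityMeasure (sourceLaw κ m ⊗ₘ κ m : Measure (Hist X m × X m)))

instance instIsMarkovKernelCausalProduct (q : ∀ i, Kernel (Hist X (i + 1) × Hist Y i) (Y i))
    [∀ i, IsMarkovKernel (q i)] : (m : ℕ) → IsMarkovKernel (causalProduct q m)
  | 0 => inferInstanceAs (IsMarkovKernel (Kernel.const _ (Measure.dirac PUnit.unit)))
  | m + 1 =>
    letI := instIsMarkovKernelCausalProduct q m
    inferInstanceAs (IsMarkovKernel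
      ((causalProduct q m).comap Hist.init Hist.measurable_init ⊗ₖ q m :
        Kernel (Hist X (m + 1)) (Hist Y m × Y m)))

theorem lintegral_sourceLaw_succ (κ : ∀ i, Kernel (Hist X i) (X i)) [∀ i, IsMarkovKernel (κ i)]
    (m : ℕ) {f : Hist X (m + 1) → ℝ≥0∞} (hf : Measurable f) :
    ∫⁻ x, f x ∂(sourceLaw κ (m + 1)) = ∫⁻ h, ∫⁻ x, f (h.snoc x) ∂(κ m h) ∂(sourceLaw κ m) :=
  Measure.lintegral_compProd (μ := sourceLaw κ m) (κ := κ m) (f := f) hf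

/-- The law of the first `m + 1` source letters and the first `m` reproduction letters. -/
noncomputable def preLaw (κ : ∀ i, Kernel (Hist X i) (X i))
    (q : ∀ i, Kernel (Hist X (i + 1) × Hist Y i) (Y i)) (m : ℕ) :
    Measure (Hist X (m + 1) × Hist Y m) :=
  sourceLaw κ (m + 1) ⊗ₘ (causalProduct q m).comap Hist.init Hist.measurable_init

/-- The rearrangement `((a, b), c) ↦ ((a, c), b)`. -/
def prodRightComm (A B C : Type*) [MeasurableSpace A] [MeasurableSpace B] [MeasurableSpace C] :
    (A × B) × C ≃ᵐ (A × C) × B where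
  toFun p := ((p.1.1, p.2), p.1.2)
  invFun p := ((p.1.1, p.2), p.1.2)
  left_inv _ := rfl
  right_inv _ := rfl
  measurable_toFun := by simp only [Equiv.coe_fn_mk]; fun_prop
  measurable_invFun := by simp only [Equiv.coe_fn_symm_mk]; fun_prop

/-- Inserting the next source letter. -/
def insertSource (X : ℕ → Type u) (Y : ℕ → Type v)
    [∀ i, MeasurableSpace (X i)] [∀ i, MeasurableSpace (Y i)] (m : ℕ) :
    (Hist X m × Hist Y m) × X m ≃ᵐ Hist X (m + 1) × Hist Y m :=
  prodRightComm (Hist X m) (Hist Y m) (X m)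

/-- Appending the next reproduction letter. -/
def appendOutput (X : ℕ → Type u) (Y : ℕ → Type v)
    [∀ i, MeasurableSpace (X i)] [∀ i, MeasurableSpace (Y i)] (m : ℕ) :
    (Hist X (m + 1) × Hist Y m) × Y m ≃ᵐ Hist X (m + 1) × Hist Y (m + 1) :=
  (MeasurableEquiv.prodAssoc : (Hist X (m + 1) × Hist Y m) × Y m ≃ᵐ _ × (Hist Y m × Y m))

theorem measurable_snoc_fst {m : ℕ} :
    Measurable fun p : (Hist X m × Hist Y m) × X m ↦ (p.1.1.snoc p.2, p.1.2) :=
  (insertSource X Y m).measurable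

section Laws

variable (κ : ∀ i, Kernel (Hist X i) (X i)) [∀ i, IsMarkovKernel (κ i)]
  (q : ∀ i, Kernel (Hist X (i + 1) × Hist Y i) (Y i)) [∀ i, IsMarkovKernel (q i)] (m : ℕ)

instance instIsProbabilityMeasureJointLaw : IsProbabilityMeasure (jointLaw κ q m) := by
  unfold jointLaw; infer_instance

instance instIsProbabilityMeasurePreLaw : IsProbabilityMeasure (preLaw κ q m) := by
  unfold preLaw; infer_instance

/-- Causality enters here: the first `m` reproduction letters do not see the source letter of index
`m`, so by Tonelli that letter may be drawn after them. -/
theorem lintegral_preLaw {f : Hist X (m + 1) × Hist Y m → ℝ≥0∞} (hf : Measurable f) :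
    ∫⁻ z, f z ∂(preLaw κ q m) =
      ∫⁻ h, ∫⁻ x, f (h.1.snoc x, h.2) ∂(κ m h.1) ∂(jointLaw κ q m) := by
  have hm : Measurable fun p : (Hist X m × Hist Y m) × X m ↦ f (p.1.1.snoc p.2, p.1.2) :=
    hf.comp measurable_snoc_fst
  have hm1 : Measurable fun h : Hist X m × Hist Y m ↦ ∫⁻ x, f (h.1.snoc x, h.2) ∂(κ m h.1) :=
    Measurable.lintegral_kernel_prod_right (κ := (κ m).comap Prod.fst measurable_fst) hm
  rw [preLaw, Measure.lintegral_compProd hf, lintegral_sourceLaw_succ, jointLaw,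
    Measure.lintegral_compProd hm1]
  · refine lintegral_congr fun h ↦ ?_
    exact lintegral_lintegral_swap (μ := κ m h) (ν := causalProduct q m h)
      (f := fun x y ↦ f (h.snoc x, y))
      (hf.comp ((Hist.measurable_snoc.comp (measurable_const.prodMk measurable_fst)).prodMk
        measurable_snd)).aemeasurable
  · exact Measurable.lintegral_kernel_prod_right
      (κ := (causalProduct q m).comap Hist.init Hist.measurable_init) hf

theorem preLaw_eq_map : preLaw κ q m =
    (jointLaw κ q m ⊗ₘ (κ m).comap Prod.fst measurable_fst).map (insertSource X Y m) := by
  refine Measure.ext_of_lintegral _ fun f hf ↦ ?_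
  rw [lintegral_preLaw κ q m hf, lintegral_map hf (insertSource X Y m).measurable,
    Measure.lintegral_compProd (f := fun a ↦ f (insertSource X Y m a))
        (hf.comp (insertSource X Y m).measurable)]
  rfl

theorem jointLaw_succ (κ : ∀ i, Kernel (Hist X i) (X i))
    (q : ∀ i, Kernel (Hist X (i + 1) × Hist Y i) (Y i)) (m : ℕ) :
    jointLaw κ q (m + 1) = (preLaw κ q m ⊗ₘ q m).map (appendOutput X Y m) :=
  (Measure.compProd_assoc' (μ := sourceLaw κ (m + 1))
    (κ := (causalProduct q m).comap Hist.init Hist.measurable_init) (η := q m)).symm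

theorem lintegral_jointLaw_succ {f : Hist X (m + 1) × Hist Y (m + 1) → ℝ≥0∞} (hf : Measurable f) :
    ∫⁻ z, f z ∂(jointLaw κ q (m + 1)) =
      ∫⁻ w, ∫⁻ y, f (w.1, w.2.snoc y) ∂(q m w) ∂(preLaw κ q m) := by
  rw [jointLaw_succ, lintegral_map hf (appendOutput X Y m).measurable,
    Measure.lintegral_compProd (f := fun a ↦ f (appendOutput X Y m a))
        (hf.comp (appendOutput X Y m).measurable)]
  rfl

theorem map_init_jointLaw_succ :
    (jointLaw κ q (m + 1)).map (fun z ↦ (z.1.init, z.2.init)) = jointLaw κ q m := by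
  have hdrop : Measurable fun z : Hist X (m + 1) × Hist Y (m + 1) ↦ (z.1.init, z.2.init) :=
    (Hist.measurable_init.comp measurable_fst).prodMk (Hist.measurable_init.comp measurable_snd)
  refine Measure.ext_of_lintegral _ fun f hf ↦ ?_
  have h1 : Measurable fun w : Hist X (m + 1) × Hist Y m ↦ f (w.1.init, w.2) :=
    hf.comp ((Hist.measurable_init.comp measurable_fst).prodMk measurable_snd)
  rw [lintegral_map hf hdrop, lintegral_jointLaw_succ κ q m
    (f := fun z ↦ f (z.1.init, z.2.init)) (hf.comp hdrop)]
  calc _ = ∫⁻ w, f (w.1.init, w.2) ∂(preLaw κ q m) := by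
        refine lintegral_congr fun w ↦ ?_
        change ∫⁻ y, f (w.1.init, w.2) ∂(q m w) = _
        simp
    _ = _ := by
        rw [lintegral_preLaw κ q m h1]
        refine lintegral_congr fun h ↦ ?_
        change ∫⁻ x, f h ∂(κ m h.1) = _
        simp

/-- Chain rule for the divergence of a causal joint law from a product law. -/
theorem klDiv_jointLaw_eq_sum (ν : ∀ i, Kernel (Hist Y i) (Y i)) [∀ i, IsMarkovKernel (ν i)] :
    klDiv (jointLaw κ q m) ((sourceLaw κ m).prod (sourceLaw ν m)) =
      ∑ i ∈ Finset.range m, klDiv (preLaw κ q i ⊗ₘ q i)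
        (preLaw κ q i ⊗ₘ (ν i).comap Prod.snd measurable_snd) := by
  induction m with
  | zero =>
    have : jointLaw κ q 0 = (sourceLaw κ 0).prod (sourceLaw ν 0) := by
      rw [← Measure.compProd_const]; rfl
    simp [this]
  | succ m ih =>
    have h1 : (sourceLaw κ (m + 1)).prod (sourceLaw ν (m + 1)) =
        ((sourceLaw κ (m + 1)).prod (sourceLaw ν m) ⊗ₘ
          (ν m).comap Prod.snd measurable_snd).map (appendOutput X Y m) := by
      refine Measure.ext_of_lintegral _ fun f hf ↦ ?_
      rw [lintegral_map hf (appendOutput X Y m).measurable,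
        Measure.lintegral_compProd (f := fun a ↦ f (appendOutput X Y m a))
        (hf.comp (appendOutput X Y m).measurable),
        lintegral_prod _ hf.aemeasurable, lintegral_prod]
      · refine lintegral_congr fun x ↦ ?_
        rw [lintegral_sourceLaw_succ ν m (f := fun y ↦ f (x, y)) (by fun_prop)]
        rfl
      · exact (Measurable.lintegral_kernel_prod_right
          (κ := (ν m).comap Prod.snd measurable_snd)
          (f := fun (w : Hist X (m + 1) × Hist Y m) y ↦ f (w.1, w.2.snoc y))
          (hf.comp (appendOutput X Y m).measurable)).aemeasurable
    have h2 : (sourceLaw κ (m + 1)).prod (sourceLaw ν m) =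
        ((sourceLaw κ m).prod (sourceLaw ν m) ⊗ₘ
          (κ m).comap Prod.fst measurable_fst).map (insertSource X Y m) := by
      refine Measure.ext_of_lintegral _ fun f hf ↦ ?_
      have hm : Measurable fun h : Hist X m × Hist Y m ↦ ∫⁻ x, f (h.1.snoc x, h.2) ∂(κ m h.1) :=
        Measurable.lintegral_kernel_prod_right (κ := (κ m).comap Prod.fst measurable_fst)
          (hf.comp (insertSource X Y m).measurable)
      rw [lintegral_map hf (insertSource X Y m).measurable,
        Measure.lintegral_compProd (f := fun a ↦ f (insertSource X Y m a))
        (hf.comp (insertSource X Y m).measurable),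
        lintegral_prod _ hf.aemeasurable, lintegral_sourceLaw_succ κ m
          (f := fun x ↦ ∫⁻ y, f (x, y) ∂(sourceLaw ν m)) hf.lintegral_prod_right']
      refine Eq.trans ?_ (lintegral_prod _ hm.aemeasurable).symm
      refine lintegral_congr fun h ↦ ?_
      exact lintegral_lintegral_swap (μ := κ m h) (ν := sourceLaw ν m)
        (f := fun x y ↦ f (h.snoc x, y))
        (hf.comp ((Hist.measurable_snoc.comp (measurable_const.prodMk measurable_fst)).prodMk
          measurable_snd)).aemeasurable
    rw [Finset.sum_range_succ, ← ih, jointLaw_succ, h1, klDiv_map_measurableEquiv,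
      klDiv_compProd_eq_add, h2]
    congr 1
    -- Both measures draw the next source letter from the same kernel `κ m`, so it contributes no
    -- divergence.
    rw [preLaw_eq_map, klDiv_map_measurableEquiv, klDiv_compProd_left]

theorem measurable_distortion {ρ : ∀ i, Hist X (i + 1) → Hist Y (i + 1) → ℝ≥0}
    (hρ : ∀ i, Measurable (Function.uncurry (ρ i))) :
    Measurable fun z : Hist X m × Hist Y m ↦ distortion ρ m z.1 z.2 := by
  induction m with
  | zero => exact measurable_const
  | succ m ih =>
    exact (ih.comp ((Hist.measurable_init.comp measurable_fst).prodMk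
      (Hist.measurable_init.comp measurable_snd))).add (hρ m)

theorem lintegral_distortion_eq_sum {ρ : ∀ i, Hist X (i + 1) → Hist Y (i + 1) → ℝ≥0}
    (hρ : ∀ i, Measurable (Function.uncurry (ρ i))) :
    ∫⁻ z, (distortion ρ m z.1 z.2 : ℝ≥0∞) ∂(jointLaw κ q m) =
      ∑ i ∈ Finset.range m, ∫⁻ w, (ρ i w.1.1 (w.1.2.snoc w.2) : ℝ≥0∞) ∂(preLaw κ q i ⊗ₘ q i) := by
  induction m with
  | zero => simp [distortion]
  | succ m ih =>
    have hdrop : Measurable fun z : Hist X (m + 1) × Hist Y (m + 1) ↦ (z.1.init, z.2.init) :=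
      (Hist.measurable_init.comp measurable_fst).prodMk (Hist.measurable_init.comp measurable_snd)
    have hm := (measurable_distortion m hρ).coe_nnreal_ennreal
    rw [Finset.sum_range_succ, ← ih]
    simp only [distortion, ENNReal.coe_add]
    rw [lintegral_add_left (f := fun z : Hist X (m + 1) × Hist Y (m + 1) ↦
      (distortion ρ m z.1.init z.2.init : ℝ≥0∞)) (hm.comp hdrop)]
    congr 1
    · conv_rhs => rw [← map_init_jointLaw_succ κ q m, lintegral_map hm hdrop]
    · rw [jointLaw_succ]
      exact lintegral_map (hρ m).coe_nnreal_ennreal (appendOutput X Y m).measurable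

end Laws

/-- Identifies the reference law of the chain rule with the true output marginal, so that for the
optimal channel the divergence there is its mutual information. -/
theorem outputLaw_eq_sourceLaw (κ : ∀ i, Kernel (Hist X i) (X i)) [∀ i, IsMarkovKernel (κ i)]
    (q : ∀ i, Kernel (Hist X (i + 1) × Hist Y i) (Y i)) {n : ℕ} {ν : ∀ i, Kernel (Hist Y i) (Y i)}
    [∀ i, IsMarkovKernel (ν i)] (hν : IsOutputConditional κ q n ν) {m : ℕ} (hm : m ≤ n + 1) :
    outputLaw κ q m = sourceLaw ν m := by
  induction m with
  | zero =>
    have : (jointLaw κ q 0) = (sourceLaw κ 0).prod (sourceLaw ν 0) := by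
      rw [← Measure.compProd_const]; rfl
    rw [outputLaw, this]
    change Measure.snd _ = _
    rw [Measure.snd_prod]
  | succ m ih => rw [hν m (by omega), ih (by omega)]; rfl

end JointLaws

/-! ### Gibbs tilting of kernels and the variational identity -/

section Gibbs

variable {α β : Type*} [MeasurableSpace α] [MeasurableSpace β]

/-- The density of the normalized tilting of `ν` by the weight `w`; it is `1` where the weight
vanishes almost everywhere. -/
noncomputable def tiltDensity (ν : Kernel α β) (w : α → β → ℝ≥0∞) (a : α) (b : β) : ℝ≥0∞ :=
  open Classical in if ∫⁻ b', w a b' ∂(ν a) = 0 then 1 else (∫⁻ b', w a b' ∂(ν a))⁻¹ * w a b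

theorem measurable_tiltDensity (ν : Kernel α β) [IsMarkovKernel ν] {w : α → β → ℝ≥0∞}
    (hw : Measurable (Function.uncurry w)) : Measurable (Function.uncurry (tiltDensity ν w)) := by
  have hZ : Measurable fun p : α × β ↦ ∫⁻ b', w p.1 b' ∂(ν p.1) :=
    hw.lintegral_kernel_prod_right.comp measurable_fst
  exact Measurable.ite (hZ (measurableSet_singleton 0)) measurable_const (hZ.inv.mul hw)

/-- The normalized tilting of the kernel `ν` by the weight `w`. -/
noncomputable def tiltKernel (ν : Kernel α β) [IsMarkovKernel ν] (w : α → β → ℝ≥0∞) :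
    Kernel α β :=
  ν.withDensity (tiltDensity ν w)

theorem lintegral_weight_le_one (ν : Kernel α β) [IsMarkovKernel ν] {w : α → β → ℝ≥0∞}
    (hw1 : ∀ a b, w a b ≤ 1) (a : α) : ∫⁻ b, w a b ∂(ν a) ≤ 1 :=
  (lintegral_mono (hw1 a)).trans (by simp)

theorem tiltKernel_apply (ν : Kernel α β) [IsMarkovKernel ν] {w : α → β → ℝ≥0∞}
    (hw : Measurable (Function.uncurry w)) {a : α} (ha : ∫⁻ b, w a b ∂(ν a) ≠ 0) :
    tiltKernel ν w a = (∫⁻ b, w a b ∂(ν a))⁻¹ • (ν a).withDensity (w a) := by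
  rw [tiltKernel, Kernel.withDensity_apply _ (measurable_tiltDensity ν hw),
    ← withDensity_smul _ hw.of_uncurry_left]
  congr 1
  ext b
  simp [tiltDensity, ha]

/-- The bound `w ≤ 1` keeps the normalizer finite; where it vanishes, the default density `1` leaves
`ν` itself, so there is no exceptional set. -/
theorem isMarkovKernel_tiltKernel (ν : Kernel α β) [IsMarkovKernel ν] {w : α → β → ℝ≥0∞}
    (hw : Measurable (Function.uncurry w)) (hw1 : ∀ a b, w a b ≤ 1) :
    IsMarkovKernel (tiltKernel ν w) := by
  refine ⟨fun a ↦ ⟨?_⟩⟩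
  by_cases ha : ∫⁻ b, w a b ∂(ν a) = 0
  · rw [tiltKernel, Kernel.withDensity_apply' _ (measurable_tiltDensity ν hw)]
    simp [tiltDensity, ha]
  · rw [tiltKernel_apply ν hw ha, Measure.smul_apply, withDensity_apply _ MeasurableSet.univ,
      setLIntegral_univ, smul_eq_mul]
    exact ENNReal.inv_mul_cancel ha
      ((lintegral_weight_le_one ν hw1 a).trans_lt ENNReal.one_lt_top).ne

theorem exp_neg_coe_le_one (f : ℝ≥0∞) : EReal.exp (-(f : EReal)) ≤ 1 := by
  rw [EReal.exp_le_one_iff, EReal.neg_le_zero]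
  exact EReal.coe_ennreal_nonneg f

theorem coe_toENNReal_neg_log {Z : ℝ≥0∞} (hZ : Z ≤ 1) :
    ((-ENNReal.log Z).toENNReal : EReal) = -ENNReal.log Z := by
  rw [EReal.coe_toENNReal]
  rw [EReal.le_neg, neg_zero]
  simpa using hZ

theorem toENNReal_neg_log_eq_top_iff {Z : ℝ≥0∞} :
    (-ENNReal.log Z).toENNReal = ∞ ↔ Z = 0 := by
  rw [EReal.toENNReal_eq_top_iff, EReal.neg_eq_top_iff, ENNReal.log_eq_bot_iff]

/-- The Gibbs variational identity. -/
theorem klDiv_compProd_add_lintegral (K : Measure α) [IsProbabilityMeasure K]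
    (q ν : Kernel α β) [IsMarkovKernel q] [IsMarkovKernel ν] {f w : α → β → ℝ≥0∞}
    (hf : Measurable (Function.uncurry f)) (hw : Measurable (Function.uncurry w))
    (hwf : ∀ a b, w a b = EReal.exp (-(f a b : EReal))) :
    klDiv (K ⊗ₘ q) (K ⊗ₘ ν) + ∫⁻ p, f p.1 p.2 ∂(K ⊗ₘ q) =
      klDiv (K ⊗ₘ q) (K ⊗ₘ tiltKernel ν w) +
        ∫⁻ a, (-ENNReal.log (∫⁻ b, w a b ∂(ν a))).toENNReal ∂K := by
  have hw1 : ∀ a b, w a b ≤ 1 := fun a b ↦ by rw [hwf]; exact exp_neg_coe_le_one _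
  have hM := isMarkovKernel_tiltKernel ν hw hw1
  set Z : α → ℝ≥0∞ := fun a ↦ ∫⁻ b, w a b ∂(ν a) with hZdef
  have hZ1 (a : α) : Z a ≤ 1 := lintegral_weight_le_one ν hw1 a
  have hZ : Measurable Z := hw.lintegral_kernel_prod_right
  have hL : Measurable fun a ↦ (-ENNReal.log (Z a)).toENNReal := by fun_prop
  by_cases hpos : ∀ᵐ a ∂K, Z a ≠ 0
  -- Here the tilting density is `e^{c - f}` with `c = -log Z`, finite almost everywhere, so the
  -- change of reference measure applies.
  · have hden : K ⊗ₘ tiltKernel ν w = (K ⊗ₘ ν).withDensity fun p ↦ tiltDensity ν w p.1 p.2 := by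
      have : IsSFiniteKernel (ν.withDensity (tiltDensity ν w)) :=
        inferInstanceAs (IsSFiniteKernel (tiltKernel ν w))
      exact Measure.compProd_withDensity (measurable_tiltDensity ν hw)
    have hprob : IsProbabilityMeasure
        ((K ⊗ₘ ν).withDensity fun p ↦ tiltDensity ν w p.1 p.2) := by
      rw [← hden]; infer_instance
    rw [hden, klDiv_add_lintegral_eq (K ⊗ₘ q) (K ⊗ₘ ν) (f := fun p ↦ f p.1 p.2)
      (c := fun p ↦ (-ENNReal.log (Z p.1)).toENNReal.toNNReal) hf
      (h := fun p ↦ tiltDensity ν w p.1 p.2) (by fun_prop) (measurable_tiltDensity ν hw)]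
    · congr 1
      rw [Measure.lintegral_compProd (by fun_prop)]
      refine lintegral_congr_ae ?_
      filter_upwards [hpos] with a ha
      simp only [lintegral_const, measure_univ, mul_one]
      exact ENNReal.coe_toNNReal (toENNReal_neg_log_eq_top_iff.not.2 ha)
    · have hpos' : ∀ᵐ p ∂(K ⊗ₘ ν), Z p.1 ≠ 0 :=
        Measure.ae_compProd_of_ae_fst ν (hZ (measurableSet_singleton 0)).compl hpos
      filter_upwards [hpos'] with p hp
      have hp' : ∫⁻ b, w p.1 b ∂(ν p.1) ≠ 0 := hp
      have hc : (((-ENNReal.log (Z p.1)).toENNReal.toNNReal : ℝ) : EReal) =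
          -ENNReal.log (Z p.1) := by
        rw [← coe_toENNReal_neg_log (hZ1 _), EReal.toENNReal_coe]
        conv_rhs => rw [← ENNReal.coe_toNNReal (toENNReal_neg_log_eq_top_iff.not.2 hp)]
        rfl
      rw [hc, sub_eq_add_neg, EReal.exp_add, EReal.exp_neg, ENNReal.exp_log, ← hwf]
      simp [tiltDensity, hp', hZdef]
  -- The partition function vanishes with positive probability, and both sides are infinite: `Z a =
  -- 0` forces `f a = ∞` almost everywhere for `ν a`, which is incompatible with finite divergence
  -- and finite mean of `f`.
  · have hR : ∫⁻ a, (-ENNReal.log (Z a)).toENNReal ∂K = ∞ := by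
      by_contra hne
      refine hpos ?_
      filter_upwards [ae_lt_top hL hne] with a ha h0
      exact ha.ne (toENNReal_neg_log_eq_top_iff.2 h0)
    rw [hR, add_top]
    by_contra hne
    obtain ⟨h1, h2⟩ := ENNReal.add_ne_top.1 hne
    have hac := (klDiv_ne_top_iff.1 h1).1
    have hfin : ∀ᵐ p ∂(K ⊗ₘ q), f p.1 p.2 < ∞ := ae_lt_top hf h2
    have hinf : ∀ᵐ p ∂(K ⊗ₘ ν), Z p.1 = 0 → f p.1 p.2 = ∞ := by
      refine Measure.ae_compProd_of_ae_ae ?_ (ae_of_all _ fun a ↦ ?_)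
      · exact (((hZ.comp measurable_fst) (measurableSet_singleton 0)).imp
          (hf (measurableSet_singleton ∞)))
      · by_cases ha : Z a = 0
        · have : w a =ᵐ[ν a] 0 := (lintegral_eq_zero_iff hw.of_uncurry_left).1 ha
          filter_upwards [this] with b hb _
          rw [hwf, Pi.zero_apply, EReal.exp_eq_zero_iff, EReal.neg_eq_bot_iff] at hb
          simpa using hb
        · simp [ha]
    refine hpos ?_
    have : ∀ᵐ p ∂(K ⊗ₘ q), Z p.1 ≠ 0 := by
      filter_upwards [hfin, hac.ae_le hinf] with p h3 h4 h5
      exact h3.ne (h4 h5)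
    filter_upwards [Measure.ae_ae_of_ae_compProd this] with a ha
    exact Filter.eventually_const.1 ha

end Gibbs

/-! ### The backward recursion and the telescoping of stage costs -/

section Recursion

variable {X : ℕ → Type u} {Y : ℕ → Type v}
  [∀ i, MeasurableSpace (X i)] [∀ i, MeasurableSpace (Y i)]

/-- Since `s ≤ 0`, the exponent is minus an element of `[0, ∞]`, the form that the Gibbs identity
requires; weights are then at most `1`. -/
theorem gibbsWeight_eq_exp_neg {s : ℝ} (hs : s ≤ 0) (r : ℝ≥0) (g : ℝ≥0∞) :
    gibbsWeight s r g = EReal.exp (-((ENNReal.ofReal (-s) * r + g : ℝ≥0∞) : EReal)) := by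
  rw [gibbsWeight]
  congr 1
  have h1 : ((ENNReal.ofReal (-s) * r : ℝ≥0∞) : EReal) = ((-(s * r) : ℝ) : EReal) := by
    rw [← ENNReal.ofReal_coe_nnreal, ← ENNReal.ofReal_mul (by linarith),
      EReal.coe_ennreal_ofReal, neg_mul,
      max_eq_left (by simpa using mul_nonpos_of_nonpos_of_nonneg hs r.2)]
  rw [EReal.coe_ennreal_add, h1, EReal.neg_add (.inl (EReal.coe_ne_bot _))
    (.inl (EReal.coe_ne_top _)), ← EReal.coe_neg, neg_neg, sub_eq_add_neg]

theorem measurable_gibbsWeight {α : Type*} [MeasurableSpace α] {s : ℝ} (hs : s ≤ 0)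
    {r : α → ℝ≥0} {g : α → ℝ≥0∞} (hr : Measurable r) (hg : Measurable g) :
    Measurable fun a ↦ gibbsWeight s (r a) (g a) := by
  simp_rw [gibbsWeight_eq_exp_neg hs]
  fun_prop

variable {κ : ∀ i, Kernel (Hist X i) (X i)} {ρ : ∀ i, Hist X (i + 1) → Hist Y (i + 1) → ℝ≥0}
  {ν : ∀ i, Kernel (Hist Y i) (Y i)} {s : ℝ}

theorem stageWeight_le_one (hs : s ≤ 0) (n i : ℕ) (x : Hist X (i + 1)) (y : Hist Y i) (y' : Y i) :
    stageWeight κ ρ ν s n i x y y' ≤ 1 := by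
  rw [stageWeight, gibbsWeight_eq_exp_neg hs]
  exact exp_neg_coe_le_one _

theorem g_self (n : ℕ) (x : Hist X (n + 1)) (y : Hist Y (n + 1)) : g κ ρ ν s n n x y = 0 := by
  simp [g, gAux]

theorem g_eq_lintegral {n i : ℕ} (hi : i < n) (x : Hist X (i + 1)) (y : Hist Y (i + 1)) :
    g κ ρ ν s n i x y =
      ∫⁻ x', (-ENNReal.log (partitionFn κ ρ ν s n (i + 1) (x.snoc x') y)).toENNReal
        ∂(κ (i + 1) x) := by
  obtain ⟨k, hk⟩ : ∃ k, n - i = k + 1 := ⟨n - i - 1, by omega⟩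
  have hk' : n - (i + 1) = k := by omega
  simp only [g, partitionFn, stageWeight, hk, hk', gAux]

theorem partitionFn_le_one [∀ i, IsMarkovKernel (ν i)] (hs : s ≤ 0) (n i : ℕ)
    (x : Hist X (i + 1)) (y : Hist Y i) : partitionFn κ ρ ν s n i x y ≤ 1 :=
  (lintegral_mono fun y' ↦ stageWeight_le_one hs n i x y y').trans (by simp)

variable [∀ i, IsMarkovKernel (κ i)] [∀ i, IsMarkovKernel (ν i)]

theorem measurable_gAux (hρ : ∀ i, Measurable (Function.uncurry (ρ i))) (hs : s ≤ 0) (k i : ℕ) :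
    Measurable (Function.uncurry (gAux κ ρ ν s k i)) := by
  induction k generalizing i with
  | zero => exact measurable_const
  | succ k ih =>
    have hτ : Measurable fun p : ((Hist X (i + 1) × Hist Y (i + 1)) × X (i + 1)) × Y (i + 1) ↦
        (p.1.1.1.snoc p.1.2, p.1.1.2.snoc p.2) :=
      (appendOutput X Y (i + 1)).measurable.comp
        (((insertSource X Y (i + 1)).measurable.comp measurable_fst).prodMk measurable_snd)
    have hW : Measurable fun p : ((Hist X (i + 1) × Hist Y (i + 1)) × X (i + 1)) × Y (i + 1) ↦
        gibbsWeight s (ρ (i + 1) (p.1.1.1.snoc p.1.2) (p.1.1.2.snoc p.2))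
          (gAux κ ρ ν s k (i + 1) (p.1.1.1.snoc p.1.2) (p.1.1.2.snoc p.2)) :=
      measurable_gibbsWeight hs ((hρ (i + 1)).comp hτ) ((ih (i + 1)).comp hτ)
    have hZ := Measurable.lintegral_kernel_prod_right
      (κ := (ν (i + 1)).comap
        (fun p : (Hist X (i + 1) × Hist Y (i + 1)) × X (i + 1) ↦ p.1.2) (by fun_prop))
      (f := fun p y' ↦ gibbsWeight s (ρ (i + 1) (p.1.1.snoc p.2) (p.1.2.snoc y'))
          (gAux κ ρ ν s k (i + 1) (p.1.1.snoc p.2) (p.1.2.snoc y'))) hW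
    exact Measurable.lintegral_kernel_prod_right
      (κ := (κ (i + 1)).comap (fun p : Hist X (i + 1) × Hist Y (i + 1) ↦ p.1) (by fun_prop))
      (f := fun p x' ↦ (-ENNReal.log (∫⁻ y',
        gibbsWeight s (ρ (i + 1) (p.1.snoc x') (p.2.snoc y'))
          (gAux κ ρ ν s k (i + 1) (p.1.snoc x') (p.2.snoc y')) ∂(ν (i + 1) p.2))).toENNReal)
      hZ.ennreal_log.neg.ereal_toENNReal

theorem measurable_g (hρ : ∀ i, Measurable (Function.uncurry (ρ i))) (hs : s ≤ 0) (n i : ℕ) :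
    Measurable fun p : (Hist X (i + 1) × Hist Y i) × Y i ↦
      g κ ρ ν s n i p.1.1 (p.1.2.snoc p.2) :=
  (measurable_gAux hρ hs (n - i) i).comp (appendOutput X Y i).measurable

theorem measurable_stageWeight (hρ : ∀ i, Measurable (Function.uncurry (ρ i))) (hs : s ≤ 0)
    (n i : ℕ) : Measurable (Function.uncurry
      fun w : Hist X (i + 1) × Hist Y i ↦ stageWeight κ ρ ν s n i w.1 w.2) :=
  measurable_gibbsWeight hs ((hρ i).comp (appendOutput X Y i).measurable) (measurable_g hρ hs n i)

theorem measurable_partitionFn (hρ : ∀ i, Measurable (Function.uncurry (ρ i))) (hs : s ≤ 0)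
    (n i : ℕ) :
    Measurable fun w : Hist X (i + 1) × Hist Y i ↦ partitionFn κ ρ ν s n i w.1 w.2 :=
  Measurable.lintegral_kernel_prod_right (κ := (ν i).comap Prod.snd measurable_snd)
    (measurable_stageWeight hρ hs n i)

theorem measurable_neg_log_partitionFn (hρ : ∀ i, Measurable (Function.uncurry (ρ i)))
    (hs : s ≤ 0) (n i : ℕ) : Measurable fun w : Hist X (i + 1) × Hist Y i ↦
      (-ENNReal.log (partitionFn κ ρ ν s n i w.1 w.2)).toENNReal :=
  (measurable_partitionFn hρ hs n i).ennreal_log.neg.ereal_toENNReal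

variable (κ ρ ν s) in
/-- The Gibbs kernel of stage `i`. -/
noncomputable def stageKernel (n i : ℕ) : Kernel (Hist X (i + 1) × Hist Y i) (Y i) :=
  tiltKernel ((ν i).comap Prod.snd measurable_snd)
    (fun w ↦ stageWeight κ ρ ν s n i w.1 w.2)

theorem isMarkovKernel_stageKernel (hρ : ∀ i, Measurable (Function.uncurry (ρ i))) (hs : s ≤ 0)
    (n i : ℕ) : IsMarkovKernel (stageKernel κ ρ ν s n i) :=
  isMarkovKernel_tiltKernel _ (measurable_stageWeight hρ hs n i)
    fun w y ↦ stageWeight_le_one hs n i w.1 w.2 y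

theorem stageKernel_apply (hρ : ∀ i, Measurable (Function.uncurry (ρ i))) (hs : s ≤ 0)
    (n i : ℕ) {w : Hist X (i + 1) × Hist Y i} (hw : partitionFn κ ρ ν s n i w.1 w.2 ≠ 0) :
    stageKernel κ ρ ν s n i w = (partitionFn κ ρ ν s n i w.1 w.2)⁻¹ •
      (ν i w.2).withDensity (stageWeight κ ρ ν s n i w.1 w.2) :=
  tiltKernel_apply ((ν i).comap Prod.snd measurable_snd) (measurable_stageWeight hρ hs n i) hw

variable (κ ρ ν s) in
/-- The cost of stage `i`: conditional divergence plus `-s` times the distortion. -/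
noncomputable def stageCost (q : ∀ i, Kernel (Hist X (i + 1) × Hist Y i) (Y i)) (i : ℕ) : ℝ≥0∞ :=
  klDiv (preLaw κ q i ⊗ₘ q i) (preLaw κ q i ⊗ₘ (ν i).comap Prod.snd measurable_snd) +
    ENNReal.ofReal (-s) * ∫⁻ w, (ρ i w.1.1 (w.1.2.snoc w.2) : ℝ≥0∞) ∂(preLaw κ q i ⊗ₘ q i)

variable (κ ρ ν s) in
/-- The conditional divergence of `q i` from the Gibbs kernel of stage `i`. -/
noncomputable def stageGap (n : ℕ) (q : ∀ i, Kernel (Hist X (i + 1) × Hist Y i) (Y i)) (i : ℕ) :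
    ℝ≥0∞ :=
  klDiv (preLaw κ q i ⊗ₘ q i) (preLaw κ q i ⊗ₘ stageKernel κ ρ ν s n i)

variable (κ ρ ν s) in
/-- The mean of `-log Z_i`. -/
noncomputable def stageValue (n : ℕ) (q : ∀ i, Kernel (Hist X (i + 1) × Hist Y i) (Y i)) (i : ℕ) :
    ℝ≥0∞ :=
  ∫⁻ w, (-ENNReal.log (partitionFn κ ρ ν s n i w.1 w.2)).toENNReal ∂(preLaw κ q i)

variable (κ ρ ν s) in
/-- The mean of `g_{i,n}`. -/
noncomputable def stageFuture (n : ℕ) (q : ∀ i, Kernel (Hist X (i + 1) × Hist Y i) (Y i)) (i : ℕ) :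
    ℝ≥0∞ :=
  ∫⁻ w, g κ ρ ν s n i w.1.1 (w.1.2.snoc w.2) ∂(preLaw κ q i ⊗ₘ q i)

variable (q : ∀ i, Kernel (Hist X (i + 1) × Hist Y i) (Y i)) [∀ i, IsMarkovKernel (q i)]

/-- The Gibbs identity with potential `-s ρ_i + g_{i,n}`, whose normalizer is `Z_i`. -/
theorem stageCost_add_stageFuture (hρ : ∀ i, Measurable (Function.uncurry (ρ i))) (hs : s ≤ 0)
    (n i : ℕ) : stageCost κ ρ ν s q i + stageFuture κ ρ ν s n q i =
      stageGap κ ρ ν s n q i + stageValue κ ρ ν s n q i := by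
  have hr : Measurable fun p : (Hist X (i + 1) × Hist Y i) × Y i ↦
      (ρ i p.1.1 (p.1.2.snoc p.2) : ℝ≥0∞) :=
    ((hρ i).comp (appendOutput X Y i).measurable).coe_nnreal_ennreal
  have hg := measurable_g (κ := κ) (ν := ν) hρ hs n i
  have := klDiv_compProd_add_lintegral (preLaw κ q i) (q i)
    ((ν i).comap Prod.snd measurable_snd)
    (f := fun w y ↦ ENNReal.ofReal (-s) * ρ i w.1 (w.2.snoc y) + g κ ρ ν s n i w.1 (w.2.snoc y))
    ((hr.const_mul _).add hg) (measurable_stageWeight (κ := κ) (ν := ν) hρ hs n i)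
    (fun w y ↦ gibbsWeight_eq_exp_neg hs _ _)
  rw [lintegral_add_left (hr.const_mul _), lintegral_const_mul _ hr, ← add_assoc] at this
  exact this

/-- The recursion in averaged form: `g_{i,n}` integrates `-log Z_{i+1}` over the next source letter,
and inserting that letter into the law of `(X^i, Y^i)` gives the law on which `Z_{i+1}` is
evaluated. -/
theorem stageFuture_eq_stageValue (hρ : ∀ i, Measurable (Function.uncurry (ρ i))) (hs : s ≤ 0)
    {n i : ℕ} (hi : i < n) :
    stageFuture κ ρ ν s n q i = stageValue κ ρ ν s n q (i + 1) := by
  have hm := measurable_neg_log_partitionFn (κ := κ) (ν := ν) hρ hs n (i + 1)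
  rw [stageValue, lintegral_preLaw κ q (i + 1) hm, jointLaw_succ,
    lintegral_map _ (appendOutput X Y i).measurable, stageFuture]
  · exact lintegral_congr fun w ↦ g_eq_lintegral hi _ _
  · exact Measurable.lintegral_kernel_prod_right
      (κ := (κ (i + 1)).comap (fun p : Hist X (i + 1) × Hist Y (i + 1) ↦ p.1) (by fun_prop))
      (f := fun p x ↦ (-ENNReal.log (partitionFn κ ρ ν s n (i + 1) (p.1.snoc x) p.2)).toENNReal)
      (hm.comp (insertSource X Y (i + 1)).measurable)

/-- Backward induction from `g_{n,n} = 0`: the value of stage `i + 1` is the mean of `g_{i,n}`,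
which is exactly what the identity of stage `i` absorbs. -/
theorem sum_Ico_stageCost (hρ : ∀ i, Measurable (Function.uncurry (ρ i))) (hs : s ≤ 0)
    {n i : ℕ} (hi : i ≤ n) : ∑ j ∈ Finset.Ico i (n + 1), stageCost κ ρ ν s q j =
      ∑ j ∈ Finset.Ico i (n + 1), stageGap κ ρ ν s n q j + stageValue κ ρ ν s n q i := by
  induction hi using Nat.decreasingInduction with
  | self =>
    have := stageCost_add_stageFuture (κ := κ) (ν := ν) q hρ hs n n
    simpa [stageFuture, g_self] using this
  | of_succ i hi ih =>
    rw [Finset.sum_eq_sum_Ico_succ_bot (by omega), ih, Finset.sum_eq_sum_Ico_succ_bot (a := i) (by omega),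
      ← stageFuture_eq_stageValue q hρ hs hi, add_left_comm,
      stageCost_add_stageFuture q hρ hs n i]
    ring

/-- The total cost of a causal channel exceeds the initial value by the sum of the gaps. -/
theorem sum_stageCost (hρ : ∀ i, Measurable (Function.uncurry (ρ i))) (hs : s ≤ 0)
    (n : ℕ) : ∑ j ∈ Finset.range (n + 1), stageCost κ ρ ν s q j =
      ∑ j ∈ Finset.range (n + 1), stageGap κ ρ ν s n q j + stageValue κ ρ ν s n q 0 := by
  rw [Finset.range_eq_Ico]
  exact sum_Ico_stageCost q hρ hs (Nat.zero_le n)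

theorem sum_stageCost_eq (hρ : ∀ i, Measurable (Function.uncurry (ρ i))) (n : ℕ) :
    ∑ j ∈ Finset.range (n + 1), stageCost κ ρ ν s q j =
      klDiv (jointLaw κ q (n + 1)) ((sourceLaw κ (n + 1)).prod (sourceLaw ν (n + 1))) +
        ENNReal.ofReal (-s) * avgDistortion κ ρ n (causalProduct q (n + 1)) := by
  rw [klDiv_jointLaw_eq_sum, avgDistortion, ← jointLaw, lintegral_distortion_eq_sum κ q (n + 1) hρ,
    Finset.mul_sum, ← Finset.sum_add_distrib]
  rfl

end Recursion

/-! ### Convexity and existence of the Lagrange multiplier -/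

section Multiplier

variable {X : ℕ → Type u} {Y : ℕ → Type v}
  [∀ i, MeasurableSpace (X i)] [∀ i, MeasurableSpace (Y i)]

/-- Mixtures of causal joint laws are causal joint laws. -/
theorem exists_jointLaw_eq_add [∀ i, StandardBorelSpace (Y i)]
    (κ : ∀ i, Kernel (Hist X i) (X i)) [∀ i, IsMarkovKernel (κ i)]
    (q₁ q₂ : ∀ i, Kernel (Hist X (i + 1) × Hist Y i) (Y i)) [∀ i, IsMarkovKernel (q₁ i)]
    [∀ i, IsMarkovKernel (q₂ i)] {a b : ℝ≥0} (hab : a + b = 1) :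
    ∃ q : ∀ i, Kernel (Hist X (i + 1) × Hist Y i) (Y i), (∀ i, IsMarkovKernel (q i)) ∧
      ∀ m, jointLaw κ q m = a • jointLaw κ q₁ m + b • jointLaw κ q₂ m := by
  have hne (i : ℕ) : Nonempty (Y i) := by
    obtain ⟨w⟩ := nonempty_of_isProbabilityMeasure (preLaw κ q₁ i)
    exact nonempty_of_isProbabilityMeasure (q₁ i w)
  -- Averaging the kernels stagewise would not average the joint laws. Instead the mixed law of each
  -- stage is disintegrated.
  let M (i : ℕ) : Measure ((Hist X (i + 1) × Hist Y i) × Y i) :=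
    a • (preLaw κ q₁ i ⊗ₘ q₁ i) + b • (preLaw κ q₂ i ⊗ₘ q₂ i)
  have hfst (i : ℕ) : (M i).fst = a • preLaw κ q₁ i + b • preLaw κ q₂ i := by
    rw [Measure.fst, Measure.map_add _ _ measurable_fst, Measure.map_smul, Measure.map_smul]
    congr 2
    · exact Measure.fst_compProd _ _
    · exact Measure.fst_compProd _ _
  refine ⟨fun i ↦ (M i).condKernel, fun i ↦ inferInstance, fun m ↦ ?_⟩
  induction m with
  | zero =>
    change jointLaw κ q₁ 0 = a • jointLaw κ q₁ 0 + b • jointLaw κ q₁ 0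
    rw [← add_smul, hab, one_smul]
  | succ m ih =>
    -- The source kernels are common, so `preLaw` is linear in `jointLaw` and the induction
    -- hypothesis carries over.
    have hpre : preLaw κ (fun i ↦ (M i).condKernel) m = (M m).fst := by
      rw [hfst]
      refine Measure.ext_of_lintegral _ fun f hf ↦ ?_
      simp only [lintegral_preLaw κ _ m hf, ih, lintegral_add_measure, lintegral_smul_measure]
    rw [jointLaw_succ, jointLaw_succ, jointLaw_succ, hpre, (M m).disintegrate,
      Measure.map_add _ _ (appendOutput X Y m).measurable, Measure.map_smul, Measure.map_smul]

theorem compProd_eq_jointLaw {κ : ∀ i, Kernel (Hist X i) (X i)} {n : ℕ}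
    {P : Kernel (Hist X (n + 1)) (Hist Y (n + 1))} [IsMarkovKernel P]
    {q : ∀ i, Kernel (Hist X (i + 1) × Hist Y i) (Y i)} [∀ i, IsMarkovKernel (q i)]
    (h : ∀ᵐ x ∂(sourceLaw κ (n + 1)), P x = causalProduct q (n + 1) x) :
    sourceLaw κ (n + 1) ⊗ₘ P = jointLaw κ q (n + 1) :=
  Measure.compProd_congr h

/-- Mixing two causal kernels mixes the distortions, and at most mixes the informations. -/
theorem exists_causal_mixture [∀ i, StandardBorelSpace (Y i)]
    (κ : ∀ i, Kernel (Hist X i) (X i)) [∀ i, IsMarkovKernel (κ i)]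
    (ρ : ∀ i, Hist X (i + 1) → Hist Y (i + 1) → ℝ≥0) {n : ℕ}
    {P₁ P₂ : Kernel (Hist X (n + 1)) (Hist Y (n + 1))} (h₁ : P₁ ∈ causalKernels κ n)
    (h₂ : P₂ ∈ causalKernels κ n) {a b : ℝ≥0} (hab : a + b = 1) :
    ∃ P : Kernel (Hist X (n + 1)) (Hist Y (n + 1)), P ∈ causalKernels κ n ∧
      avgDistortion κ ρ n P = a * avgDistortion κ ρ n P₁ + b * avgDistortion κ ρ n P₂ ∧
      mutualInfo (sourceLaw κ (n + 1)) P ≤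
        a * mutualInfo (sourceLaw κ (n + 1)) P₁ + b * mutualInfo (sourceLaw κ (n + 1)) P₂ := by
  obtain ⟨hM₁, q₁, hq₁, e₁⟩ := h₁
  obtain ⟨hM₂, q₂, hq₂, e₂⟩ := h₂
  obtain ⟨q, hq, hJ⟩ := exists_jointLaw_eq_add κ q₁ q₂ hab
  have hJ' : sourceLaw κ (n + 1) ⊗ₘ causalProduct q (n + 1) =
      a • (sourceLaw κ (n + 1) ⊗ₘ P₁) + b • (sourceLaw κ (n + 1) ⊗ₘ P₂) := by
    rw [compProd_eq_jointLaw e₁, compProd_eq_jointLaw e₂]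
    exact hJ (n + 1)
  refine ⟨causalProduct q (n + 1), ⟨inferInstance, q, hq, ae_of_all _ fun _ ↦ rfl⟩, ?_, ?_⟩
  · simp only [avgDistortion, hJ', lintegral_add_measure, lintegral_smul_measure]
    rfl
  · simp only [mutualInfo, hJ']
    rw [Measure.map_add _ _ measurable_snd, Measure.map_smul, Measure.map_smul, Measure.prod_add,
      Measure.prod_smul_right, Measure.prod_smul_right]
    refine (klDiv_add_le _ _ _ _).trans ?_
    rw [klDiv_smul_same, klDiv_smul_same]

/-- Supporting line with negative slope. -/
theorem exists_neg_slope {S : Set (ℝ × ℝ)} {D r : ℝ}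
    (hS : ∀ p₁ ∈ S, ∀ p₂ ∈ S, ∀ a b : ℝ, 0 ≤ a → 0 ≤ b → a + b = 1 →
      a * p₁.1 + b * p₂.1 ≤ D → r ≤ a * p₁.2 + b * p₂.2)
    (h₁ : ∃ p ∈ S, p.1 < D) (h₂ : ∃ p ∈ S, p.2 < r) :
    ∃ s < 0, ∀ p ∈ S, r + s * (p.1 - D) ≤ p.2 := by
  have hle : ∀ p ∈ S, p.1 ≤ D → r ≤ p.2 := fun p hp h ↦ by
    have := hS p hp p hp 1 0 zero_le_one le_rfl (by norm_num) (by linarith)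
    linarith
  have hcross : ∀ p₁ ∈ S, p₁.1 < D → ∀ p₂ ∈ S, D < p₂.1 →
      (r - p₁.2) / (D - p₁.1) ≤ (p₂.2 - r) / (p₂.1 - D) := by
    intro p₁ hp₁ hlt₁ p₂ hp₂ hlt₂
    have hd : 0 < p₂.1 - p₁.1 := by linarith
    -- The weights place the mixture of the two points exactly at abscissa `D`.
    have := hS p₁ hp₁ p₂ hp₂ ((p₂.1 - D) / (p₂.1 - p₁.1)) ((D - p₁.1) / (p₂.1 - p₁.1))
      (div_nonneg (by linarith) hd.le) (div_nonneg (by linarith) hd.le)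
      (by field_simp; ring) (by apply le_of_eq; field_simp; ring)
    rw [div_mul_eq_mul_div, div_mul_eq_mul_div, ← add_div, le_div_iff₀ hd] at this
    rw [div_le_div_iff₀ (by linarith) (by linarith)]
    linarith
  obtain ⟨p₁, hp₁, hlt₁⟩ := h₁
  obtain ⟨p₂, hp₂, hr₂⟩ := h₂
  have hlt₂ : D < p₂.1 := by
    by_contra h
    exact absurd (hle p₂ hp₂ (not_lt.1 h)) (not_le.2 hr₂)
  -- Slopes from `(D, r)` to points on the right; points on the left bound them below. The infimum
  -- is negative because `p₂` lies to the right and below `r`.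
  set T : Set ℝ := {t | ∃ p ∈ S, D < p.1 ∧ t = (p.2 - r) / (p.1 - D)} with hT
  have hTne : T.Nonempty := ⟨_, p₂, hp₂, hlt₂, rfl⟩
  have hTb : BddBelow T := ⟨(r - p₁.2) / (D - p₁.1), by
    rintro _ ⟨p, hp, hlt, rfl⟩
    exact hcross p₁ hp₁ hlt₁ p hp hlt⟩
  refine ⟨sInf T, (csInf_le hTb ⟨p₂, hp₂, hlt₂, rfl⟩).trans_lt
    (div_neg_of_neg_of_pos (by linarith) (by linarith)), fun p hp ↦ ?_⟩
  rcases lt_trichotomy p.1 D with h | h | h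
  · have : (r - p.2) / (D - p.1) ≤ sInf T := le_csInf hTne (by
      rintro _ ⟨p', hp', hlt', rfl⟩
      exact hcross p hp h p' hp' hlt')
    rw [div_le_iff₀ (by linarith)] at this
    linarith
  · rw [h, sub_self, mul_zero, add_zero]
    exact hle p hp h.le
  · have : sInf T ≤ (p.2 - r) / (p.1 - D) := csInf_le hTb ⟨p, hp, h, rfl⟩
    rw [le_div_iff₀ (by linarith)] at this
    linarith

/-- The Lagrangian inequality, in `EReal` and in `ℝ≥0∞`. -/
theorem coe_le_lagrangian_iff {R I ℓ : ℝ≥0∞} {D : ℝ≥0} {s : ℝ} (hs : s ≤ 0) :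
    (R : EReal) ≤ (I : EReal) - (s : EReal) * ((ℓ : EReal) - ((D : ℝ) : EReal)) ↔
      R + ENNReal.ofReal (-s) * D ≤ I + ENNReal.ofReal (-s) * ℓ := by
  rcases hs.eq_or_lt with rfl | hs
  · simp
  have hs' : ENNReal.ofReal (-s) ≠ 0 := by simpa using hs
  induction ℓ with
  | top =>
    have h1 : (s : EReal) * (((⊤ : ℝ≥0∞) : EReal) - ((D : ℝ) : EReal)) = ⊥ := by
      rw [EReal.coe_ennreal_top, EReal.top_sub_coe, EReal.coe_mul_top_of_neg hs]
    rw [h1, EReal.sub_bot (EReal.coe_ennreal_ne_bot _), ENNReal.mul_top hs']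
    simp
  | coe ℓ =>
    have h1 : (s : EReal) * (((ℓ : ℝ≥0∞) : EReal) - ((D : ℝ) : EReal)) =
        ((s * (ℓ - D) : ℝ) : EReal) := rfl
    rw [h1]
    induction I with
    | top => rw [EReal.coe_ennreal_top, EReal.top_sub_coe]; simp
    | coe I =>
      have h2 : (((I : ℝ≥0∞) : EReal) - ((s * (ℓ - D) : ℝ) : EReal)) =
        ((I - s * (ℓ - D) : ℝ) : EReal) := rfl
      rw [h2]
      have e : ENNReal.ofReal (-s) = ((-s).toNNReal : ℝ≥0∞) := rfl
      induction R with
      | top =>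
        rw [e]
        simp only [EReal.coe_ennreal_top, top_le_iff, top_add]
        exact ⟨fun h ↦ absurd h (EReal.coe_ne_top _),
          fun h ↦ absurd h (by exact_mod_cast ENNReal.coe_ne_top)⟩
      | coe R =>
        have h3 : ((R : ℝ≥0∞) : EReal) = ((R : ℝ) : EReal) := rfl
        rw [h3, EReal.coe_le_coe_iff, e]
        norm_cast
        rw [← NNReal.coe_le_coe]
        push_cast
        rw [Real.coe_toNNReal _ (by linarith)]
        constructor <;> intro h <;> linarith

variable {κ : ∀ i, Kernel (Hist X i) (X i)} {ρ : ∀ i, Hist X (i + 1) → Hist Y (i + 1) → ℝ≥0}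
  {n : ℕ} {D : ℝ≥0} {s : ℝ}

theorem IsLagrangeMultiplier.le (h : IsLagrangeMultiplier κ ρ n D s)
    {P : Kernel (Hist X (n + 1)) (Hist Y (n + 1))} (hP : P ∈ causalKernels κ n) :
    causalRDF κ ρ n D + ENNReal.ofReal (-s) * D ≤
      mutualInfo (sourceLaw κ (n + 1)) P + ENNReal.ofReal (-s) * avgDistortion κ ρ n P := by
  rw [← coe_le_lagrangian_iff h.1, h.2]
  exact iInf₂_le P hP

/-- The other inequality is weak duality: when the distortion is at most `D`, the penalty `-s (ℓ -
D)` is nonpositive. -/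
theorem isLagrangeMultiplier_of_le (hs : s ≤ 0)
    (h : ∀ P : Kernel (Hist X (n + 1)) (Hist Y (n + 1)), P ∈ causalKernels κ n →
      causalRDF κ ρ n D + ENNReal.ofReal (-s) * D ≤
        mutualInfo (sourceLaw κ (n + 1)) P + ENNReal.ofReal (-s) * avgDistortion κ ρ n P) :
    IsLagrangeMultiplier κ ρ n D s := by
  refine ⟨hs, le_antisymm (le_iInf₂ fun P hP ↦ (coe_le_lagrangian_iff hs).2 (h P hP)) ?_⟩
  -- Truncating the Lagrangian infimum at `0` moves the comparison to `ℝ≥0∞`, where `causalRDF` is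
  -- an infimum.
  refine ((le_max_right 0 _).trans_eq EReal.coe_toENNReal_eq_max.symm).trans
    (EReal.coe_ennreal_le_coe_ennreal_iff.2 ?_)
  refine le_iInf₂ fun P hP ↦ ?_
  refine EReal.toENNReal_le_toENNReal (iInf₂_le P hP.1) |>.trans ?_
  have hℓ : avgDistortion κ ρ n P ≠ ⊤ := (hP.2.trans_lt ENNReal.coe_lt_top).ne
  have hle := hP.2
  lift avgDistortion κ ρ n P to ℝ≥0 using hℓ with ℓ
  have h1 : (s : EReal) * (((ℓ : ℝ≥0∞) : EReal) - ((D : ℝ) : EReal)) =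
      ((s * (ℓ - D) : ℝ) : EReal) := rfl
  have h2 : (0 : ℝ) ≤ s * (ℓ - D) :=
    mul_nonneg_of_nonpos_of_nonpos hs (by
      have : (ℓ : ℝ) ≤ D := by exact_mod_cast hle
      linarith)
  rw [h1]
  generalize mutualInfo (sourceLaw κ (n + 1)) P = I
  rw [← EReal.coe_ennreal_le_coe_ennreal_iff]
  induction I with
  | top => simp
  | coe I =>
    refine EReal.coe_ennreal_le_coe_ennreal_iff.2
      ((EReal.toENNReal_le_toENNReal ?_).trans_eq EReal.toENNReal_coe)
    change ((I - s * (ℓ - D) : ℝ) : EReal) ≤ ((I : ℝ) : EReal)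
    exact EReal.coe_le_coe_iff.2 (by linarith)

theorem exists_isLagrangeMultiplier [∀ i, StandardBorelSpace (Y i)] [∀ i, IsMarkovKernel (κ i)]
    (h₁ : ∃ D₁ < D, causalRDF κ ρ n D₁ ≠ ⊤)
    (h₂ : causalRDF κ ρ n D = 0 ∨ ∃ D₂, causalRDF κ ρ n D₂ < causalRDF κ ρ n D) :
    ∃ s : ℝ, IsLagrangeMultiplier κ ρ n D s := by
  rcases h₂ with h0 | ⟨D₂, hD₂⟩
  · exact ⟨0, isLagrangeMultiplier_of_le le_rfl fun P _ ↦ by simp [h0]⟩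
  obtain ⟨D₁, hD₁, hfin⟩ := h₁
  obtain ⟨P₁, hP₁, hI₁⟩ : ∃ P ∈ fidelitySet κ ρ n D₁,
      mutualInfo (sourceLaw κ (n + 1)) P < ⊤ := by
    simpa [causalRDF, iInf_lt_iff] using lt_top_iff_ne_top.2 hfin
  obtain ⟨P₂, hP₂, hI₂⟩ : ∃ P ∈ fidelitySet κ ρ n D₂,
      mutualInfo (sourceLaw κ (n + 1)) P < causalRDF κ ρ n D := by
    simpa only [causalRDF, iInf_lt_iff, exists_prop] using hD₂
  have hR : causalRDF κ ρ n D ≠ ⊤ := by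
    refine ((iInf₂_le P₁ ⟨hP₁.1, hP₁.2.trans ?_⟩).trans_lt hI₁).ne
    exact_mod_cast hD₁.le
  have hℓ₁ : avgDistortion κ ρ n P₁ < D := hP₁.2.trans_lt (by exact_mod_cast hD₁)
  set r := (causalRDF κ ρ n D).toReal with hr
  let S : Set (ℝ × ℝ) := {p | ∃ P : Kernel (Hist X (n + 1)) (Hist Y (n + 1)),
    P ∈ causalKernels κ n ∧ avgDistortion κ ρ n P ≠ ⊤ ∧
      mutualInfo (sourceLaw κ (n + 1)) P ≠ ⊤ ∧
      p = ((avgDistortion κ ρ n P).toReal, (mutualInfo (sourceLaw κ (n + 1)) P).toReal)}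
  have hS : ∀ p₁ ∈ S, ∀ p₂ ∈ S, ∀ a b : ℝ, 0 ≤ a → 0 ≤ b → a + b = 1 →
      a * p₁.1 + b * p₂.1 ≤ D → r ≤ a * p₁.2 + b * p₂.2 := by
    rintro _ ⟨P, hP, hℓ, hI, rfl⟩ _ ⟨P', hP', hℓ', hI', rfl⟩ a b ha hb hab hle
    lift a to ℝ≥0 using ha
    lift b to ℝ≥0 using hb
    have hab' : a + b = 1 := by exact_mod_cast hab
    obtain ⟨Q, hQ, hQℓ, hQI⟩ := exists_causal_mixture κ ρ hP hP' hab'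
    have ht (c : ℝ≥0) {x : ℝ≥0∞} (hx : x ≠ ⊤) : (c : ℝ≥0∞) * x ≠ ⊤ :=
      ENNReal.mul_ne_top ENNReal.coe_ne_top hx
    have hQD : avgDistortion κ ρ n Q ≤ D := by
      rw [hQℓ, ← ENNReal.toReal_le_toReal (ENNReal.add_ne_top.2 ⟨ht a hℓ, ht b hℓ'⟩)
        ENNReal.coe_ne_top, ENNReal.toReal_add (ht a hℓ) (ht b hℓ')]
      simpa using hle
    have hle' : causalRDF κ ρ n D ≤ a * mutualInfo (sourceLaw κ (n + 1)) P +
        b * mutualInfo (sourceLaw κ (n + 1)) P' := (iInf₂_le Q ⟨hQ, hQD⟩).trans hQI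
    have := (ENNReal.toReal_le_toReal hR (ENNReal.add_ne_top.2 ⟨ht a hI, ht b hI'⟩)).2 hle'
    rw [ENNReal.toReal_add (ht a hI) (ht b hI')] at this
    simpa using this
  obtain ⟨s, hs, hsup⟩ := exists_neg_slope hS
    ⟨_, ⟨P₁, hP₁.1, hℓ₁.ne_top, hI₁.ne, rfl⟩, by
      simpa using (ENNReal.toReal_lt_toReal hℓ₁.ne_top ENNReal.coe_ne_top).2 hℓ₁⟩
    ⟨_, ⟨P₂, hP₂.1, (hP₂.2.trans_lt ENNReal.coe_lt_top).ne, hI₂.ne_top, rfl⟩,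
      (ENNReal.toReal_lt_toReal hI₂.ne_top hR).2 hI₂⟩
  refine ⟨s, isLagrangeMultiplier_of_le hs.le fun P hP ↦ ?_⟩
  -- The strict sign of `s` matters here: for `s = 0` infinite distortion would carry no penalty.
  by_cases hℓ : avgDistortion κ ρ n P = ⊤
  · have hs' : ENNReal.ofReal (-s) ≠ 0 := by simpa using hs
    simp [hℓ, ENNReal.mul_top hs']
  by_cases hI : mutualInfo (sourceLaw κ (n + 1)) P = ⊤
  · simp [hI]
  have h := hsup _ ⟨P, hP, hℓ, hI, rfl⟩
  have e : ENNReal.ofReal (-s) ≠ ⊤ := ENNReal.ofReal_ne_top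
  rw [← ENNReal.toReal_le_toReal (ENNReal.add_ne_top.2 ⟨hR, ENNReal.mul_ne_top e (by simp)⟩)
    (ENNReal.add_ne_top.2 ⟨hI, ENNReal.mul_ne_top e hℓ⟩),
    ENNReal.toReal_add hR (ENNReal.mul_ne_top e (by simp)),
    ENNReal.toReal_add hI (ENNReal.mul_ne_top e hℓ), ENNReal.toReal_mul, ENNReal.toReal_mul,
    ENNReal.toReal_ofReal (by linarith), ENNReal.coe_toReal]
  simp only at h
  linarith

end Multiplier

/-! ### Vanishing gaps at the optimum and the terms of the rate formula -/

section Optimality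

variable {X : ℕ → Type u} {Y : ℕ → Type v}
  [∀ i, MeasurableSpace (X i)] [∀ i, MeasurableSpace (Y i)]
  {κ : ∀ i, Kernel (Hist X i) (X i)} [∀ i, IsMarkovKernel (κ i)]
  {q : ∀ i, Kernel (Hist X (i + 1) × Hist Y i) (Y i)} [∀ i, IsMarkovKernel (q i)]

theorem ae_ae_of_ae_preLaw {m : ℕ} {p : Hist X (m + 1) × Hist Y m → Prop}
    (h : ∀ᵐ w ∂(preLaw κ q m), p w) :
    ∀ᵐ h ∂(jointLaw κ q m), ∀ᵐ x ∂(κ m h.1), p (h.1.snoc x, h.2) := by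
  rw [preLaw_eq_map] at h
  have h' := Measure.ae_ae_of_ae_compProd (p := fun z ↦ p (insertSource X Y m z))
    (ae_of_ae_map (insertSource X Y m).measurable.aemeasurable h)
  filter_upwards [h'] with z hz
  rwa [Kernel.comap_apply] at hz

theorem integral_preLaw {m : ℕ} {f : Hist X (m + 1) × Hist Y m → ℝ}
    (hf : Integrable f (preLaw κ q m)) :
    ∫ w, f w ∂(preLaw κ q m) =
      ∫ h, ∫ x, f (h.1.snoc x, h.2) ∂(κ m h.1) ∂(jointLaw κ q m) := by
  rw [preLaw_eq_map] at hf ⊢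
  rw [integrable_map_equiv] at hf
  rw [integral_map_equiv, Measure.integral_compProd (f := fun z ↦ f (insertSource X Y m z)) hf]
  rfl

variable {ρ : ∀ i, Hist X (i + 1) → Hist Y (i + 1) → ℝ≥0}
  {ν : ∀ i, Kernel (Hist Y i) (Y i)} [∀ i, IsMarkovKernel (ν i)] {s : ℝ} {n : ℕ}

theorem measurable_lintegral_g (hρ : ∀ i, Measurable (Function.uncurry (ρ i))) (hs : s ≤ 0)
    (i : ℕ) : Measurable fun w : Hist X (i + 1) × Hist Y i ↦
      ∫⁻ y, g κ ρ ν s n i w.1 (w.2.snoc y) ∂(q i w) :=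
  Measurable.lintegral_kernel_prod_right
    (f := fun (w : Hist X (i + 1) × Hist Y i) y ↦ g κ ρ ν s n i w.1 (w.2.snoc y))
    (measurable_g hρ hs n i)

theorem stageFuture_eq_lintegral (hρ : ∀ i, Measurable (Function.uncurry (ρ i))) (hs : s ≤ 0)
    (i : ℕ) : stageFuture κ ρ ν s n q i =
      ∫⁻ w, ∫⁻ y, g κ ρ ν s n i w.1 (w.2.snoc y) ∂(q i w) ∂(preLaw κ q i) :=
  Measure.lintegral_compProd (measurable_g hρ hs n i)

/-- The `i`-th term of the rate formula. -/
theorem integral_stage_eq (hρ : ∀ i, Measurable (Function.uncurry (ρ i))) (hs : s ≤ 0) {i : ℕ}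
    (hF : stageFuture κ ρ ν s n q i ≠ ⊤) (hV : stageValue κ ρ ν s n q i ≠ ⊤) :
    ∫ h, ∫ x, (-(∫ y, (g κ ρ ν s n i (h.1.snoc x) (h.2.snoc y)).toReal ∂(q i (h.1.snoc x, h.2)))
        - (ENNReal.log (partitionFn κ ρ ν s n i (h.1.snoc x) h.2)).toReal)
        ∂(κ i h.1) ∂(jointLaw κ q i) =
      (stageValue κ ρ ν s n q i).toReal - (stageFuture κ ρ ν s n q i).toReal := by
  have hAm := measurable_lintegral_g (κ := κ) (q := q) (ν := ν) (n := n) hρ hs i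
  have hBm := measurable_neg_log_partitionFn (κ := κ) (ν := ν) hρ hs n i
  rw [stageFuture_eq_lintegral hρ hs] at hF ⊢
  rw [stageValue] at hV ⊢
  set A : Hist X (i + 1) × Hist Y i → ℝ≥0∞ :=
    fun w ↦ ∫⁻ y, g κ ρ ν s n i w.1 (w.2.snoc y) ∂(q i w) with hA
  set B : Hist X (i + 1) × Hist Y i → ℝ≥0∞ :=
    fun w ↦ (-ENNReal.log (partitionFn κ ρ ν s n i w.1 w.2)).toENNReal with hB
  have hAfin : ∀ᵐ w ∂(preLaw κ q i), A w < ⊤ := ae_lt_top hAm hF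
  have hBfin : ∀ᵐ w ∂(preLaw κ q i), B w < ⊤ := ae_lt_top hBm hV
  have hAi : Integrable (fun w ↦ (A w).toReal) (preLaw κ q i) :=
    integrable_toReal_of_lintegral_ne_top hAm.aemeasurable hF
  have hBi : Integrable (fun w ↦ (B w).toReal) (preLaw κ q i) :=
    integrable_toReal_of_lintegral_ne_top hBm.aemeasurable hV
  rw [← integral_toReal hAm.aemeasurable hAfin, ← integral_toReal hBm.aemeasurable hBfin,
    ← integral_sub hBi hAi, integral_preLaw (f := fun w ↦ (B w).toReal - (A w).toReal)
      (hBi.sub hAi)]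
  refine integral_congr_ae ?_
  filter_upwards [ae_ae_of_ae_preLaw hAfin] with h hh
  refine integral_congr_ae ?_
  filter_upwards [hh] with x hx
  have hgm : Measurable fun y ↦ g κ ρ ν s n i (h.1.snoc x) (h.2.snoc y) :=
    (measurable_g (κ := κ) (ν := ν) hρ hs n i).comp
      (measurable_const (a := ((h.1.snoc x, h.2) : Hist X (i + 1) × Hist Y i)) |>.prodMk
        measurable_id)
  have e1 : ∫ y, (g κ ρ ν s n i (h.1.snoc x) (h.2.snoc y)).toReal ∂(q i (h.1.snoc x, h.2)) =
      (A (h.1.snoc x, h.2)).toReal :=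
    integral_toReal hgm.aemeasurable (ae_lt_top hgm hx.ne)
  have e2 : (B (h.1.snoc x, h.2)).toReal =
      -(ENNReal.log (partitionFn κ ρ ν s n i (h.1.snoc x) h.2)).toReal := by
    rw [hB, EReal.toReal_toENNReal, EReal.toReal_neg_eq]
    rw [EReal.le_neg, neg_zero, ENNReal.log_le_zero_iff]
    exact partitionFn_le_one hs n i _ _
  rw [e1, e2]
  ring

theorem stageGap_stageKernel (hρ : ∀ i, Measurable (Function.uncurry (ρ i))) (hs : s ≤ 0)
    (i : ℕ) : stageGap κ ρ ν s n (stageKernel κ ρ ν s n) i = 0 := by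
  have := isMarkovKernel_stageKernel (κ := κ) (ν := ν) hρ hs n
  rw [stageGap, klDiv_self]

/-- The gaps of an optimal causal channel vanish, and its initial value is the value of the
Lagrangian. -/
theorem stageGap_eq_zero_and_stageValue_eq [∀ i, StandardBorelSpace (X i)]
    (hρ : ∀ i, Measurable (Function.uncurry (ρ i))) {D : ℝ≥0}
    {P : Kernel (Hist X (n + 1)) (Hist Y (n + 1))} (hP : P ∈ fidelitySet κ ρ n D)
    (hopt : mutualInfo (sourceLaw κ (n + 1)) P = causalRDF κ ρ n D)
    (hfin : causalRDF κ ρ n D ≠ ⊤)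
    (hPq : ∀ᵐ x ∂(sourceLaw κ (n + 1)), P x = causalProduct q (n + 1) x)
    (hν : IsOutputConditional κ q n ν) (hL : IsLagrangeMultiplier κ ρ n D s) :
    (∀ i ≤ n, stageGap κ ρ ν s n q i = 0) ∧
      stageValue κ ρ ν s n q 0 = causalRDF κ ρ n D + ENNReal.ofReal (-s) * D ∧
      ∑ i ∈ Finset.range (n + 1), stageCost κ ρ ν s q i ≠ ⊤ := by
  have hs := hL.1
  have hMP : IsMarkovKernel P := hP.1.1
  have hJ : sourceLaw κ (n + 1) ⊗ₘ P = jointLaw κ q (n + 1) := compProd_eq_jointLaw hPq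
  have hcost : ∑ i ∈ Finset.range (n + 1), stageCost κ ρ ν s q i =
      causalRDF κ ρ n D + ENNReal.ofReal (-s) * avgDistortion κ ρ n P := by
    rw [sum_stageCost_eq q hρ n, ← hopt, mutualInfo, avgDistortion, avgDistortion, hJ,
      ← outputLaw, outputLaw_eq_sourceLaw κ q hν le_rfl]
    rfl
  -- Feasibility bounds the cost above and the multiplier inequality bounds it below, which is
  -- complementary slackness.
  have hcost' : ∑ i ∈ Finset.range (n + 1), stageCost κ ρ ν s q i =
      causalRDF κ ρ n D + ENNReal.ofReal (-s) * D := by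
    refine le_antisymm (hcost.trans_le ?_) ?_
    · gcongr
      exact hP.2
    · rw [hcost]
      simpa only [hopt] using hL.le hP.1
  have htop : ∑ i ∈ Finset.range (n + 1), stageCost κ ρ ν s q i ≠ ⊤ := by
    rw [hcost']
    exact ENNReal.add_ne_top.2
      ⟨hfin, ENNReal.mul_ne_top ENNReal.ofReal_ne_top ENNReal.coe_ne_top⟩
  have hsum := sum_stageCost (κ := κ) (ν := ν) q hρ hs n
  have hG := isMarkovKernel_stageKernel (κ := κ) (ν := ν) hρ hs n
  -- The multiplier inequality is tested on the Gibbs channel. Its output law need not be the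
  -- `ν`-law, whence `mutualInfo_le`.
  have hle : ∑ i ∈ Finset.range (n + 1), stageCost κ ρ ν s q i ≤ stageValue κ ρ ν s n q 0 := by
    calc _ ≤ mutualInfo (sourceLaw κ (n + 1)) (causalProduct (stageKernel κ ρ ν s n) (n + 1)) +
          ENNReal.ofReal (-s) *
            avgDistortion κ ρ n (causalProduct (stageKernel κ ρ ν s n) (n + 1)) := by
          rw [hcost']
          exact hL.le ⟨inferInstance, _, hG, ae_of_all _ fun _ ↦ rfl⟩
      _ ≤ ∑ i ∈ Finset.range (n + 1), stageCost κ ρ ν s (stageKernel κ ρ ν s n) i := by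
          rw [sum_stageCost_eq _ hρ n]
          gcongr
          exact mutualInfo_le _ _ _
      _ = stageValue κ ρ ν s n q 0 := by
          rw [sum_stageCost _ hρ hs n,
            Finset.sum_eq_zero fun i _ ↦ stageGap_stageKernel hρ hs i, zero_add]
          -- The initial law involves no reproduction letter, so the initial values of the two
          -- channels coincide by definition.
          rfl
  have hV : stageValue κ ρ ν s n q 0 ≠ ⊤ := fun h ↦ htop (by rw [hsum, h, add_top])
  have hgap : ∑ i ∈ Finset.range (n + 1), stageGap κ ρ ν s n q i = 0 := by
    rw [hsum] at hle
    by_contra hne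
    exact (ENNReal.lt_add_right hV hne).not_ge (by rwa [add_comm] at hle)
  refine ⟨fun i hi ↦ ?_, ?_, htop⟩
  · exact Finset.sum_eq_zero_iff.1 hgap i (Finset.mem_range.2 (by omega))
  · rw [← hcost', hsum, hgap, zero_add]

/-- The value of a stage is dominated by the cost of the stages from it onwards. -/
theorem stageValue_ne_top (hρ : ∀ i, Measurable (Function.uncurry (ρ i))) (hs : s ≤ 0)
    (h : ∑ i ∈ Finset.range (n + 1), stageCost κ ρ ν s q i ≠ ⊤) {i : ℕ} (hi : i ≤ n) :
    stageValue κ ρ ν s n q i ≠ ⊤ := by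
  refine ne_top_of_le_ne_top h ?_
  calc stageValue κ ρ ν s n q i ≤ ∑ j ∈ Finset.Ico i (n + 1), stageCost κ ρ ν s q j := by
        rw [sum_Ico_stageCost q hρ hs hi]; exact le_add_self
    _ ≤ _ := by
        rw [Finset.range_eq_Ico]
        exact Finset.sum_le_sum_of_subset (Finset.Ico_subset_Ico_left (Nat.zero_le i))

theorem stageFuture_ne_top (hρ : ∀ i, Measurable (Function.uncurry (ρ i))) (hs : s ≤ 0)
    (h : ∑ i ∈ Finset.range (n + 1), stageCost κ ρ ν s q i ≠ ⊤) {i : ℕ} (hi : i ≤ n) :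
    stageFuture κ ρ ν s n q i ≠ ⊤ := by
  rcases hi.eq_or_lt with rfl | hi
  · simp [stageFuture, g_self]
  · rw [stageFuture_eq_stageValue q hρ hs hi]
    exact stageValue_ne_top hρ hs h hi

end Optimality

end CausalRDF

/-! ### The main theorem -/

open CausalRDF in
theorem mainTheorem2 {X : ℕ → Type*} {Y : ℕ → Type*}
    [∀ i, MeasurableSpace (X i)] [∀ i, StandardBorelSpace (X i)]
    [∀ i, MeasurableSpace (Y i)] [∀ i, StandardBorelSpace (Y i)]
    (n : ℕ)
    (κ : ∀ i, Kernel (Hist X i) (X i)) [∀ i, IsMarkovKernel (κ i)]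
    (ρ : ∀ i, Hist X (i + 1) → Hist Y (i + 1) → ℝ≥0)
    (hρ : ∀ i, Measurable (Function.uncurry (ρ i)))
    (D : ℝ≥0) :
    -- existence of the Lagrange multiplier
    ((∃ D₁ < D, causalRDF κ ρ n D₁ ≠ ⊤) →
      (causalRDF κ ρ n D = 0 ∨ ∃ D₂, causalRDF κ ρ n D₂ < causalRDF κ ρ n D) →
      ∃ s : ℝ, IsLagrangeMultiplier κ ρ n D s) ∧
    -- form of every optimal reproduction kernel, and of the causal RDF
    (∀ P ∈ fidelitySet κ ρ n D,
      mutualInfo (sourceLaw κ (n + 1)) P = causalRDF κ ρ n D →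
      causalRDF κ ρ n D ≠ ⊤ →
      ∀ q : ∀ i, Kernel (Hist X (i + 1) × Hist Y i) (Y i), (∀ i, IsMarkovKernel (q i)) →
      (∀ᵐ x ∂(sourceLaw κ (n + 1)), P x = causalProduct q (n + 1) x) →
      ∀ ν : ∀ i, Kernel (Hist Y i) (Y i), (∀ i, IsMarkovKernel (ν i)) →
      IsOutputConditional κ q n ν →
      ∀ s : ℝ, IsLagrangeMultiplier κ ρ n D s →
      (∀ i ≤ n, ∀ᵐ h ∂(jointLaw κ q i), ∀ᵐ x ∂(κ i h.1),
        partitionFn κ ρ ν s n i (h.1.snoc x) h.2 ≠ 0 ∧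
        partitionFn κ ρ ν s n i (h.1.snoc x) h.2 ≠ ⊤ ∧
        q i (h.1.snoc x, h.2) =
          (partitionFn κ ρ ν s n i (h.1.snoc x) h.2)⁻¹ •
            (ν i h.2).withDensity (stageWeight κ ρ ν s n i (h.1.snoc x) h.2)) ∧
      (∀ i ≤ n,
        ∫⁻ h, ∫⁻ x, ∫⁻ y, g κ ρ ν s n i (h.1.snoc x) (h.2.snoc y)
          ∂(q i (h.1.snoc x, h.2)) ∂(κ i h.1) ∂(jointLaw κ q i) ≠ ⊤ ∧
        ∫⁻ h, ∫⁻ x, (-ENNReal.log (partitionFn κ ρ ν s n i (h.1.snoc x) h.2)).toENNReal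
          ∂(κ i h.1) ∂(jointLaw κ q i) ≠ ⊤) ∧
      (causalRDF κ ρ n D).toReal = s * D +
        ∑ i ∈ Finset.range (n + 1),
          ∫ h, ∫ x,
            (-(∫ y, (g κ ρ ν s n i (h.1.snoc x) (h.2.snoc y)).toReal
                ∂(q i (h.1.snoc x, h.2)))
              - (ENNReal.log (partitionFn κ ρ ν s n i (h.1.snoc x) h.2)).toReal)
            ∂(κ i h.1) ∂(jointLaw κ q i)) := by
  refine ⟨exists_isLagrangeMultiplier, ?_⟩
  intro P hP hopt hfin q hq hPq ν hνM hν s hL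
  have hs := hL.1
  obtain ⟨hgap, hval, htop⟩ := stageGap_eq_zero_and_stageValue_eq hρ hP hopt hfin hPq hν hL
  have hV : ∀ i ≤ n, stageValue κ ρ ν s n q i ≠ ⊤ := fun i hi ↦ stageValue_ne_top hρ hs htop hi
  have hF : ∀ i ≤ n, stageFuture κ ρ ν s n q i ≠ ⊤ := fun i hi ↦ stageFuture_ne_top hρ hs htop hi
  have hG := isMarkovKernel_stageKernel (κ := κ) (ν := ν) hρ hs n
  refine ⟨fun i hi ↦ ?_, fun i hi ↦ ⟨?_, ?_⟩, ?_⟩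
  -- A zero gap equates two joint laws with the same first marginal; disintegrations are almost
  -- everywhere unique.
  · have hq_eq : ∀ᵐ w ∂(preLaw κ q i), q i w = stageKernel κ ρ ν s n i w :=
      Kernel.ae_eq_of_compProd_eq (klDiv_eq_zero_iff.1 (hgap i hi))
    have hZ : ∀ᵐ w ∂(preLaw κ q i), partitionFn κ ρ ν s n i w.1 w.2 ≠ 0 := by
      filter_upwards [ae_lt_top (measurable_neg_log_partitionFn hρ hs n i) (hV i hi)] with w hw h0
      exact hw.ne (toENNReal_neg_log_eq_top_iff.2 h0)
    filter_upwards [ae_ae_of_ae_preLaw (hq_eq.and hZ)] with h hh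
    filter_upwards [hh] with x hx
    exact ⟨hx.2, ((partitionFn_le_one hs n i _ _).trans_lt ENNReal.one_lt_top).ne,
      hx.1.trans (stageKernel_apply hρ hs n i hx.2)⟩
  · have := hF i hi
    rwa [stageFuture_eq_lintegral hρ hs,
      lintegral_preLaw κ q i (measurable_lintegral_g hρ hs i)] at this
  · have := hV i hi
    rwa [stageValue, lintegral_preLaw κ q i (measurable_neg_log_partitionFn hρ hs n i)] at this
  -- The mean of `g_{i,n}` cancels the value of stage `i + 1`, and the last one is `0`, so only the
  -- initial value survives.
  · have hsum : ∑ i ∈ Finset.range (n + 1), ((stageValue κ ρ ν s n q i).toReal -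
        (stageFuture κ ρ ν s n q i).toReal) = (stageValue κ ρ ν s n q 0).toReal := by
      rw [Finset.sum_range_succ, Finset.sum_congr rfl (g := fun i ↦
        (stageValue κ ρ ν s n q i).toReal - (stageValue κ ρ ν s n q (i + 1)).toReal) fun i hi ↦ by
          rw [stageFuture_eq_stageValue q hρ hs (Finset.mem_range.1 hi)],
        Finset.sum_range_sub']
      simp [stageFuture, g_self]
    rw [Finset.sum_congr rfl fun i hi ↦ integral_stage_eq hρ hs
      (hF i (Finset.mem_range_succ_iff.1 hi)) (hV i (Finset.mem_range_succ_iff.1 hi)), hsum, hval,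
      ENNReal.toReal_add hfin (ENNReal.mul_ne_top ENNReal.ofReal_ne_top ENNReal.coe_ne_top),
      ENNReal.toReal_mul, ENNReal.toReal_ofReal (by linarith), ENNReal.coe_toReal]
    ring
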